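/- For a finite simple graph $G$, let $\rho(G)$ be its spectral radius, i.e. the largest modulus of an eigenvalue of its adjacency matrix. For an integer $r\ge 1$, let $\theta_{r+1}=\theta(1,2,r+1)$ be the graph formed by two vertices connected by three internally disjoint paths of lengths $1$, $2$ and $r+1$. A graph is $\theta_{r+1}$-free if it has no subgraph (not necessarily induced) isomorphic to $\theta_{r+1}$. Let $ex_{sp}(n,\theta_{r+1})$ be the maximum of $\rho(G)$ over all $\theta_{r+1}$-free graphs $G$ on $n$ vertices, and let $T_{n,2}$ be the complete bipartite graph on $n$ vertices whose parts have sizes $\lfloor n/2\rfloor$ and $\lceil n/2\rceil$. Theorem. Let $r\ge 1$, and let $n\ge 10r$ if $r$ is odd and $n\ge 7r$ if $r$ is even. Then $T_{n,2}$ is, up to isomorphism, the unique $\theta_{r+1}$-free graph on $n$ vertices with spectral radius $ex_{sp}(n,\theta_{r+1})$. That is, a graph $G$ on $n$ vertices is $\theta_{r+1}$-free with $\rho(G)=ex_{sp}(n,\theta_{r+1})$ if and only if $G\cong T_{n,2}$. -/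

import Mathlib

/-- Vertices of the generalized theta graph with path lengths `l i`: the two end vertices, and
`l i - 1` internal vertices on the `i`-th path. -/
inductive ThetaVertex {t : ℕ} (l : Fin t → ℕ) : Type
  | source : ThetaVertex l
  | target : ThetaVertex l
  | inner (i : Fin t) (k : Fin (l i - 1)) : ThetaVertex l

/-- The vertex at position `k` on the `i`-th path: position `0` is the source, positions
`1, …, l i - 1` are the internal vertices, position `l i` is the target. -/
def ThetaVertex.point {t : ℕ} (l : Fin t → ℕ) (i : Fin t) (k : ℕ) : ThetaVertex l :=
  if k = 0 then .source
  else if h : k - 1 < l i - 1 then .inner i ⟨k - 1, h⟩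
  else .target

/-- The generalized theta graph `θ(l₁, …, l_t)`: two vertices connected by `t` internally
disjoint paths of lengths `l₁, …, l_t` (all lengths positive, at most one of them equal to `1`).
The edges join consecutive positions of the same path. -/
def generalizedTheta {t : ℕ} (l : Fin t → ℕ) : SimpleGraph (ThetaVertex l) :=
  SimpleGraph.fromRel fun u v =>
    ∃ (i : Fin t) (k : ℕ), k < l i ∧ u = ThetaVertex.point l i k ∧ v = ThetaVertex.point l i (k + 1)

open Classical in
/-- The spectral radius `ρ(G)`: the largest modulus of the eigenvalues of the adjacency matrix
(a real symmetric matrix, so that all its eigenvalues are real). -/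
noncomputable def graphSpectralRadius {V : Type*} [Fintype V] (G : SimpleGraph V) : ℝ :=
  (spectralRadius ℝ (G.adjMatrix ℝ)).toReal

/-- `ex_sp(n, H)`: the maximum of `ρ(G)` over the `H`-free graphs `G` on `n` vertices. -/
noncomputable def exSp {W : Type*} (n : ℕ) (H : SimpleGraph W) : ℝ :=
  sSup {x : ℝ | ∃ G : SimpleGraph (Fin n), H.Free G ∧ graphSpectralRadius G = x}

/-- `G` belongs to `Ex_sp(n, H)`, where `n` is the order of `G`. -/
def IsSpectralExtremal {W V : Type*} [Fintype V] (H : SimpleGraph W) (G : SimpleGraph V) : Prop :=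
  H.Free G ∧ graphSpectralRadius G = exSp (Fintype.card V) H

/-- The supremum in `exSp` is a maximum as soon as there is an `H`-free graph on `n` vertices. -/
theorem exSp_isGreatest {W : Type*} (n : ℕ) (H : SimpleGraph W)
    (h : ∃ G : SimpleGraph (Fin n), H.Free G) :
    IsGreatest {x : ℝ | ∃ G : SimpleGraph (Fin n), H.Free G ∧ graphSpectralRadius G = x}
      (exSp n H) := by
  have hfin : {x : ℝ | ∃ G : SimpleGraph (Fin n),
      H.Free G ∧ graphSpectralRadius G = x}.Finite :=
    (Set.toFinite {G : SimpleGraph (Fin n) | H.Free G}).image graphSpectralRadius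
  obtain ⟨G, hG⟩ := h
  exact ⟨Set.Nonempty.csSup_mem ⟨_, G, hG, rfl⟩ hfin,
    fun _ hx => le_csSup hfin.bddAbove hx⟩

/-! Write `N` for the neighbourhood of a vertex `u`, `W` for the vertices outside `N ∪ {u}`, and
`S(u)` for the sum of the degrees over `N`, which is a row sum of the squared adjacency matrix.
Evaluating that square at an entry of an eigenvector of largest modulus gives `ρ² ≤ S(u)` for some
`u`, so it suffices to show `S(u) ≤ ⌊n²/4⌋` and to settle equality.

If `N` is independent, then `S(u) ≤ |N|(n - |N|) ≤ ⌊n²/4⌋`. If `N` contains an edge, the inequality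
is strict (`sum_degree_lt`). Here `S(u) = |N| + 2e(N) + e(N, W)`. Theta-freeness forbids paths on `r
+ 2` vertices in `N`, so Erdős–Gallai (`innerDegreeSum_le_of_no_path`) bounds `e(N)`. It also
forbids long alternating paths between `N` and `W` from suitable vertices of `N`; a depth-first
search argument (`exists_superset_of_no_path`) turns this into a set `K` meeting few `N`–`W` edges.
The loss at `K` outweighs the gain inside `N` once `n` is large against `r`. For odd `r` parity
requires a three-vertex path in `N`; when `N` spans only a matching, a separate count applies.

If `S(u) = ⌊n²/4⌋`, then `N` is independent and completely joined to its complement. The complement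
is the neighbourhood of any `v ∈ N` and attains the bound too, so it is independent as well. Thus
`G` is bipartite with at least as many edges as `T_{n,2}`, and Turán's theorem identifies it. An
explicit eigenvector shows that `T_{n,2}` attains the bound. -/

open Finset

/-! ### Finding theta graphs from a triangle and a path -/

namespace SimpleGraph

variable {V : Type*} {G : SimpleGraph V}

/-- A triangle `a b c` and a path from `a` to `b` with inner vertices `l` avoiding `c` form a theta
graph `θ(1, 2, r + 1)`. -/
theorem theta_isContained {r : ℕ} {a b c : V} {l : List V} (hlen : l.length = r)
    (hnd : (a :: (l ++ [b])).Nodup) (hch : (a :: (l ++ [b])).IsChain G.Adj)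
    (hab : G.Adj a b) (hac : G.Adj a c) (hcb : G.Adj c b) (hc : c ∉ l) :
    (generalizedTheta ![1, 2, r + 1]).IsContained G := by
  set f : ThetaVertex ![1, 2, r + 1] → V := fun x => match x with
    | .source => a
    | .target => b
    -- The path of length 1 has no inner vertex and the path of length 2 has `c`. The default in
    -- `getD` is never reached, since `k < l.length` on the long path.
    | .inner i k => if i = 2 then l.getD k c else c with hf
  have hin : ∀ (k : Fin (![1, 2, r + 1] 2 - 1)), f (.inner 2 k) = l[(k : ℕ)]'(by
      have := k.2; simp at this; omega) := by
    intro k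
    have : (k : ℕ) < l.length := by have := k.2; simp at this; omega
    change (if (2 : Fin 3) = 2 then l.getD k c else c) = _
    rw [if_pos rfl, List.getD_eq_getElem _ _ this]
  have h2 : ∀ k (hk : k ≤ r + 1),
      f (ThetaVertex.point ![1, 2, r + 1] 2 k) = (a :: (l ++ [b]))[k]'(by simp; omega) := by
    intro k hk
    unfold ThetaVertex.point
    split_ifs with h0 h1
    · subst h0; simp [hf]
    · have h1' : k - 1 < r := by simpa using h1
      obtain ⟨j, rfl⟩ : ∃ j, k = j + 1 := ⟨k - 1, by omega⟩
      rw [hin]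
      simp only [List.getElem_cons_succ, Nat.add_sub_cancel]
      rw [List.getElem_append_left]
    · have h1' : ¬ k - 1 < r := by simpa using h1
      have : k = l.length + 1 := by omega
      subst this
      simp [hf]
  have hadj : ∀ u v, (∃ (i : Fin 3) (k : ℕ), k < ![1, 2, r + 1] i ∧
      u = ThetaVertex.point ![1, 2, r + 1] i k ∧ v = ThetaVertex.point ![1, 2, r + 1] i (k + 1)) →
      G.Adj (f u) (f v) := by
    rintro u v ⟨i, k, hk, rfl, rfl⟩
    fin_cases i
    · have : k = 0 := by simpa using hk
      subst this
      simpa [ThetaVertex.point, hf] using hab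
    · have : k = 0 ∨ k = 1 := by simp at hk; omega
      rcases this with rfl | rfl
      · simpa [ThetaVertex.point, hf] using hac
      · simpa [ThetaVertex.point, hf] using hcb
    · have hk' : k < r + 1 := by simpa using hk
      have e1 := h2 k (by omega)
      have e2 := h2 (k + 1) (by omega)
      change G.Adj (f (ThetaVertex.point _ 2 k)) (f (ThetaVertex.point _ 2 (k + 1)))
      rw [e1, e2]
      exact (List.isChain_iff_getElem.1 hch) k (by simp; omega)
  have hnd' := hnd
  simp only [List.nodup_cons, List.mem_append, List.mem_singleton, not_or,
    List.nodup_append] at hnd'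
  obtain ⟨⟨hal, hne⟩, hl, -, hlb⟩ := hnd'
  have hbl : b ∉ l := fun h => hlb b h b (by simp) rfl
  have hmem : ∀ k, f (.inner 2 k) ∈ l := fun k => by rw [hin]; exact List.getElem_mem _
  have h1 : ∀ k, f (.inner 1 k) = c := fun k => by simp [hf]
  refine ⟨⟨⟨f, ?_⟩, ?_⟩⟩
  · intro u v huv
    rw [generalizedTheta, SimpleGraph.fromRel_adj] at huv
    rcases huv.2 with h | h
    · exact hadj _ _ h
    · exact (hadj _ _ h).symm
  · intro u v huv
    change f u = f v at huv
    have key : ∀ x : ThetaVertex ![1, 2, r + 1], x = .source ∨ x = .target ∨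
        (∃ k, x = .inner 1 k) ∨ ∃ k, x = .inner 2 k := by
      intro x
      rcases x with _ | _ | ⟨i, k⟩
      · simp
      · simp
      · fin_cases i
        · exact absurd k.2 (by simp)
        · exact .inr (.inr (.inl ⟨k, rfl⟩))
        · exact .inr (.inr (.inr ⟨k, rfl⟩))
    have hs : f .source = a := rfl
    have ht : f .target = b := rfl
    have hca := hac.ne
    have hcb' := hcb.ne
    rcases key u with rfl | rfl | ⟨k, rfl⟩ | ⟨k, rfl⟩ <;>
    rcases key v with rfl | rfl | ⟨j, rfl⟩ | ⟨j, rfl⟩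
    · rfl
    · exact absurd huv hne
    · exact absurd (huv.trans (h1 j)) hca
    · exact absurd (by rw [← hs, huv]; exact hmem j) hal
    · exact absurd huv.symm hne
    · rfl
    · exact absurd (huv.trans (h1 j)).symm hcb'
    · exact absurd (by rw [← ht, huv]; exact hmem j) hbl
    · exact absurd ((h1 k).symm.trans huv).symm hca
    · exact absurd ((h1 k).symm.trans huv) hcb'
    · have e : k = j := Fin.ext (by have := k.2; have := j.2; simp at *; omega)
      rw [e]
    · exact absurd (by rw [← h1 k, huv]; exact hmem j) hc
    · exact absurd (by rw [← hs, ← huv]; exact hmem k) hal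
    · exact absurd (by rw [← ht, ← huv]; exact hmem k) hbl
    · exact absurd (by rw [← h1 j, ← huv]; exact hmem k) hc
    · rw [hin, hin, hl.getElem_inj_iff] at huv
      rw [Fin.ext huv]

/-- A theta-free graph has no path with `r + 2` vertices that avoids `u`, starts with an edge
inside the neighbourhood of `u` and ends in this neighbourhood. -/
theorem not_isChain_of_theta_free {r : ℕ} (hG : (generalizedTheta ![1, 2, r + 1]).Free G)
    {u a b : V} {l : List V} (hlen : l.length = r) (hnd : (a :: b :: l).Nodup)
    (hch : (a :: b :: l).IsChain G.Adj) (hu : u ∉ l) (ha : G.Adj u a) (hb : G.Adj u b)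
    (hl : ∀ x ∈ l.getLast?, G.Adj u x) : False := by
  -- The branch vertices are `b` and `u`: they are joined by an edge, through `a`, and along `l`.
  refine hG (theta_isContained (a := b) (b := u) (c := a) (l := l) hlen ?_ ?_ hb.symm ?_ ha.symm ?_)
  · simp only [List.nodup_cons, List.mem_cons, not_or] at hnd
    simp only [List.nodup_cons, List.mem_append, List.mem_singleton, not_or, List.nodup_append]
    refine ⟨⟨hnd.2.1, hb.ne'⟩, hnd.2.2, by simp, ?_⟩
    rintro x hx y rfl rfl
    exact hu hx
  · have h1 := List.isChain_of_isChain_cons hch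
    rw [← List.cons_append, List.isChain_append]
    refine ⟨h1, by simp, ?_⟩
    intro x hx y hy
    simp only [List.head?_cons, Option.mem_def, Option.some.injEq] at hy
    subst hy
    rw [List.getLast?_cons] at hx
    cases hq : l.getLast? with
    | none => simp [hq] at hx; subst hx; exact hb.symm
    | some z => simp [hq] at hx; subst hx; exact (hl _ hq).symm
  · exact (List.isChain_cons_cons.1 hch).1.symm
  · simp only [List.nodup_cons, List.mem_cons, not_or] at hnd
    exact hnd.1.2

/-! ### Counting ordered adjacent pairs inside a set -/

/-- The number of ordered pairs of adjacent vertices of `A`. -/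
def innerDegreeSum (G : SimpleGraph V) [DecidableRel G.Adj] (A : Finset V) : ℕ :=
  ∑ v ∈ A, #{w ∈ A | G.Adj v w}

variable [DecidableRel G.Adj]

theorem innerDegreeSum_eq_card (A : Finset V) :
    G.innerDegreeSum A = #{p ∈ A ×ˢ A | G.Adj p.1 p.2} := by
  rw [innerDegreeSum, card_filter, sum_product]
  exact sum_congr rfl fun v _ => card_filter _ _

variable [DecidableEq V]

theorem innerDegreeSum_erase {A : Finset V} {v : V} (hv : v ∈ A) :
    G.innerDegreeSum A ≤ G.innerDegreeSum (A.erase v) + 2 * #{w ∈ A | G.Adj v w} := by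
  rw [innerDegreeSum_eq_card, innerDegreeSum_eq_card]
  set N := ({w ∈ A | G.Adj v w} : Finset V)
  have : ({p ∈ A ×ˢ A | G.Adj p.1 p.2} : Finset (V × V)) ⊆
      ({p ∈ A.erase v ×ˢ A.erase v | G.Adj p.1 p.2} : Finset (V × V)) ∪
        (N.image (fun w => (v, w)) ∪ N.image (fun w => (w, v))) := by
    rintro ⟨x, y⟩ h
    simp only [mem_filter, mem_product, mem_union, mem_image, mem_erase, N] at h ⊢
    by_cases hx : x = v
    · subst hx; exact .inr (.inl ⟨y, ⟨h.1.2, h.2⟩, rfl⟩)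
    by_cases hy : y = v
    · subst hy; exact .inr (.inr ⟨x, ⟨h.1.1, h.2.symm⟩, rfl⟩)
    exact .inl ⟨⟨⟨hx, h.1.1⟩, ⟨hy, h.1.2⟩⟩, h.2⟩
  have h1 := (card_le_card this).trans (card_union_le _ _)
  have h2 := card_union_le (N.image (fun w => (v, w))) (N.image (fun w => (w, v)))
  have h3 := card_image_le (s := N) (f := fun w => (v, w))
  have h4 := card_image_le (s := N) (f := fun w => (w, v))
  omega

theorem innerDegreeSum_sdiff_of_closed {A K : Finset V}
    (hcl : ∀ v ∈ K, ∀ w ∈ A, G.Adj v w → w ∈ K) :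
    G.innerDegreeSum A ≤ G.innerDegreeSum (A \ K) + G.innerDegreeSum K := by
  simp only [innerDegreeSum_eq_card]
  refine (card_le_card ?_).trans (card_union_le _ _)
  rintro ⟨x, y⟩ h
  simp only [mem_filter, mem_product, mem_union, mem_sdiff] at h ⊢
  have h1 := hcl x
  have h2 := hcl y
  have h3 := h.2.symm
  tauto

end SimpleGraph

/-! ### Erdős–Gallai theorem for paths -/

namespace SimpleGraph

variable {V : Type*} {G : SimpleGraph V} [DecidableEq V]

/-- A nonempty set of vertices spans a path of maximum length. -/
theorem exists_longest_isChain {A : Finset V} (hA : A.Nonempty) :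
    ∃ l : List V, l ≠ [] ∧ l.Nodup ∧ l.IsChain G.Adj ∧ (∀ x ∈ l, x ∈ A) ∧
      ∀ l' : List V, l'.Nodup → l'.IsChain G.Adj → (∀ x ∈ l', x ∈ A) → l'.length ≤ l.length := by
  set S : Set ℕ := {m | ∃ l : List V, l.Nodup ∧ l.IsChain G.Adj ∧ (∀ x ∈ l, x ∈ A) ∧ l.length = m}
  have hb : BddAbove S := by
    refine ⟨#A, ?_⟩
    rintro m ⟨l, h1, -, h3, rfl⟩
    rw [← List.toFinset_card_of_nodup h1]
    exact card_le_card fun x hx => h3 x (by simpa using hx)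
  obtain ⟨a, ha⟩ := hA
  have h1 : 1 ∈ S := ⟨[a], by simp, by simp, by simpa using ha, rfl⟩
  obtain ⟨l, hl1, hl2, hl3, hl4⟩ := Nat.sSup_mem ⟨1, h1⟩ hb
  refine ⟨l, ?_, hl1, hl2, hl3, fun l' a1 a2 a3 => hl4 ▸ le_csSup hb ⟨l', a1, a2, a3, rfl⟩⟩
  rintro rfl
  have := le_csSup hb h1
  simp only [List.length_nil] at hl4
  omega

/-- The vertices of a longest path that closes to a cycle have no neighbours off the path. -/
theorem mem_of_adj_of_longest_cycle {A : Finset V} {l : List V} (hnd : l.Nodup)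
    (hch : l.IsChain G.Adj) (hlA : ∀ x ∈ l, x ∈ A)
    (hcyc : ∀ x ∈ l.getLast?, ∀ y ∈ l.head?, G.Adj x y)
    (hmax : ∀ l' : List V, l'.Nodup → l'.IsChain G.Adj → (∀ x ∈ l', x ∈ A) →
      l'.length ≤ l.length)
    {v w : V} (hv : v ∈ l) (hw : w ∈ A) (hvw : G.Adj v w) : w ∈ l := by
  by_contra hwl
  obtain ⟨s, t, rfl⟩ := List.append_of_mem hv
  -- Cutting the cycle open at `v` makes `v` an end, so prepending `w` would give a longer path.
  have hp : (v :: t ++ s).Perm (s ++ v :: t) := List.perm_append_comm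
  have hmem : ∀ x, x ∈ v :: t ++ s ↔ x ∈ s ++ v :: t := fun x => hp.mem_iff
  rw [List.isChain_append] at hch
  have := hmax (w :: (v :: t ++ s)) (by
      rw [List.nodup_cons, hmem, hp.nodup_iff]
      exact ⟨hwl, hnd⟩) (by
      rw [List.cons_append, List.isChain_cons_cons, ← List.cons_append, List.isChain_append]
      refine ⟨hvw.symm, hch.2.1, hch.1, fun x hx y hy => hcyc x ?_ y ?_⟩
      · rw [List.getLast?_append, Option.mem_def.1 hx]; rfl
      · rw [List.head?_append, Option.mem_def.1 hy]; rfl) (by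
      intro x hx
      rcases List.mem_cons.1 hx with rfl | hx
      · exact hw
      · exact hlA x ((hmem x).1 hx))
  simp only [List.length_append, List.length_cons] at this
  omega

variable [DecidableRel G.Adj]

/-- If the ends of a longest path have large degree sum, then its vertices span a cycle. -/
theorem exists_cycle_of_longest {A : Finset V} {l : List V} (hne : l ≠ []) (hnd : l.Nodup)
    (hch : l.IsChain G.Adj) (hlA : ∀ x ∈ l, x ∈ A)
    (hmax : ∀ l' : List V, l'.Nodup → l'.IsChain G.Adj → (∀ x ∈ l', x ∈ A) →
      l'.length ≤ l.length)
    (hdeg : l.length ≤ #{w ∈ A | G.Adj (l.head hne) w} + #{w ∈ A | G.Adj (l.getLast hne) w}) :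
    ∃ c : List V, c.Perm l ∧ c.IsChain G.Adj ∧
      ∀ x ∈ c.getLast?, ∀ y ∈ c.head?, G.Adj x y := by
  have hpos : 0 < l.length := List.length_pos_iff.2 hne
  have hhead : ∀ w ∈ A, G.Adj (l.head hne) w → w ∈ l := by
    intro w hw hadj
    by_contra hwl
    have := hmax (w :: l) (List.nodup_cons.2 ⟨hwl, hnd⟩)
      (hch.cons_of_ne_nil hne hadj.symm) (by simpa using ⟨hw, hlA⟩)
    simp at this
  have hlast : ∀ w ∈ A, G.Adj (l.getLast hne) w → w ∈ l := by
    intro w hw hadj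
    by_contra hwl
    have := hmax (l ++ [w]) (by
        rw [← List.concat_eq_append]; exact hnd.concat hwl) (by
        rw [List.isChain_append]
        refine ⟨hch, by simp, fun x hx y hy => ?_⟩
        rw [List.getLast?_eq_getLast_of_ne_nil hne] at hx
        simp only [Option.mem_def, Option.some.injEq, List.head?_cons] at hx hy
        rw [← hx, ← hy]; exact hadj) (by
        intro x hx
        rcases List.mem_append.1 hx with hx | hx
        · exact hlA x hx
        · rw [List.mem_singleton.1 hx]; exact hw)
    simp at this
  -- Neighbours of the head are recorded by the index of their predecessor. A common index `i` of
  -- `I` and `J` then means that the head is joined to position `i + 1` and the last vertex to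
  -- position `i`.
  set I := ({w ∈ A | G.Adj (l.head hne) w} : Finset V).image fun w => l.idxOf w - 1
  set J := ({w ∈ A | G.Adj (l.getLast hne) w} : Finset V).image fun w => l.idxOf w
  have hidx0 : ∀ w ∈ l, G.Adj (l.head hne) w → 1 ≤ l.idxOf w := by
    intro w hw hadj
    by_contra h0
    have h0 : l.idxOf w = 0 := by omega
    have h1 := List.getElem_idxOf (List.idxOf_lt_length_iff.2 hw)
    simp only [h0] at h1
    rw [← List.head_eq_getElem hne] at h1
    exact hadj.ne h1
  have hidxl : ∀ w ∈ l, G.Adj (l.getLast hne) w → l.idxOf w < l.length - 1 := by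
    intro w hw hadj
    have h2 := List.idxOf_lt_length_iff.2 hw
    by_contra h0
    have h0 : l.idxOf w = l.length - 1 := by omega
    have h1 := List.getElem_idxOf h2
    simp only [h0] at h1
    rw [← List.getLast_eq_getElem hne] at h1
    exact hadj.ne h1
  have hI : #I = #{w ∈ A | G.Adj (l.head hne) w} := by
    refine card_image_of_injOn fun x hx y hy hxy => ?_
    simp only [coe_filter, Set.mem_ofPred_eq] at hx hy
    have e1 := hidx0 x (hhead x hx.1 hx.2) hx.2
    have e2 := hidx0 y (hhead y hy.1 hy.2) hy.2
    have e3 : l.idxOf x - 1 = l.idxOf y - 1 := hxy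
    exact (List.idxOf_inj (hhead x hx.1 hx.2)).1 (by omega)
  have hJ : #J = #{w ∈ A | G.Adj (l.getLast hne) w} := by
    refine card_image_of_injOn fun x hx y hy hxy => ?_
    simp only [coe_filter, Set.mem_ofPred_eq] at hx hy
    exact (List.idxOf_inj (hlast x hx.1 hx.2)).1 hxy
  have hIJ : I ∪ J ⊆ range (l.length - 1) := by
    intro i hi
    simp only [I, J, mem_union, mem_image, mem_filter, mem_range] at hi ⊢
    rcases hi with ⟨w, ⟨hw, hadj⟩, rfl⟩ | ⟨w, ⟨hw, hadj⟩, rfl⟩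
    · have e1 := hidx0 w (hhead w hw hadj) hadj
      have e2 := List.idxOf_lt_length_iff.2 (hhead w hw hadj)
      omega
    · exact hidxl w (hlast w hw hadj) hadj
  -- Pigeonhole: at least `l.length` indices, with multiplicity, lie in `l.length - 1` places.
  have hint : (I ∩ J).Nonempty := by
    rw [← card_pos]
    have e1 := card_union_add_card_inter I J
    have e2 := card_le_card hIJ
    rw [card_range] at e2
    omega
  obtain ⟨i, hi⟩ := hint
  simp only [I, J, mem_inter, mem_image, mem_filter] at hi
  obtain ⟨⟨x, ⟨hx, hxadj⟩, hxi⟩, ⟨y, ⟨hy, hyadj⟩, hyi⟩⟩ := hi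
  have hxl := hhead x hx hxadj
  have hyl := hlast y hy hyadj
  have e1 := hidx0 x hxl hxadj
  have e2 := List.idxOf_lt_length_iff.2 hxl
  have hx' := List.getElem_idxOf e2
  have hy' := List.getElem_idxOf (List.idxOf_lt_length_iff.2 hyl)
  have hxi' : l.idxOf x = i + 1 := by omega
  simp only [hxi'] at hx' e2
  simp only [hyi] at hy'
  have hsplit := List.take_append_drop (i + 1) l
  have hp := (List.isChain_append.1 (hsplit.symm ▸ hch)).1
  have hq := (List.isChain_append.1 (hsplit.symm ▸ hch)).2.1
  have hpne : l.take (i + 1) ≠ [] := by simp [hne]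
  have hph : (l.take (i + 1)).head? = some (l.head hne) := by
    rw [List.head?_take]; simp [List.head?_eq_some_head hne]
  have hpl : (l.take (i + 1)).getLast? = some y := by
    rw [List.getLast?_take]; simp [← hy', List.getElem?_eq_getElem (show i < l.length by omega)]
  have hqh : (l.drop (i + 1)).head? = some x := by
    rw [List.head?_drop, List.getElem?_eq_getElem e2, hx']
  have hql : (l.drop (i + 1)).getLast? = some (l.getLast hne) := by
    rw [List.getLast?_drop, if_neg (by omega), List.getLast?_eq_getLast_of_ne_nil hne]
  -- Reversing the initial segment makes the chord from the head the middle link and the chord from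
  -- the last vertex the closing edge.
  refine ⟨(l.take (i + 1)).reverse ++ l.drop (i + 1), ?_, ?_, ?_⟩
  · conv_rhs => rw [← hsplit]
    exact (List.reverse_perm _).append_right _
  · rw [List.isChain_append]
    refine ⟨?_, hq, ?_⟩
    · rw [List.isChain_reverse]
      exact hp.imp fun _ _ h => h.symm
    · intro a ha b hb
      rw [List.getLast?_reverse, hph] at ha
      rw [hqh] at hb
      simp only [Option.mem_def, Option.some.injEq] at ha hb
      rw [← ha, ← hb]; exact hxadj
  · intro a ha b hb
    rw [List.getLast?_append, hql] at ha
    rw [List.head?_append, List.head?_reverse, hpl] at hb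
    simp only [Option.mem_def, Option.some.injEq, Option.some_or] at ha hb
    rw [← ha, ← hb]; exact hyadj

/-- **Erdős–Gallai theorem** for paths: if `A` spans no path with `r + 2` vertices, then the
average degree inside `A` is at most `r`. -/
theorem innerDegreeSum_le_of_no_path {r : ℕ} (A : Finset V)
    (h : ∀ l : List V, l.Nodup → l.IsChain G.Adj → (∀ x ∈ l, x ∈ A) → l.length ≠ r + 2) :
    G.innerDegreeSum A ≤ r * #A := by
  induction A using Finset.strongInduction with
  | H A ih =>
  rcases A.eq_empty_or_nonempty with rfl | hA
  · simp [innerDegreeSum]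
  have ih' : ∀ B ⊂ A, G.innerDegreeSum B ≤ r * #B := fun B hB =>
    ih B hB fun l h1 h2 h3 => h l h1 h2 fun x hx => hB.1 (h3 x hx)
  obtain ⟨l, hne, hnd, hch, hlA, hmax⟩ := exists_longest_isChain (G := G) hA
  have hlen : l.length ≤ r + 1 := by
    by_contra hlt
    refine h (l.take (r + 2)) (hnd.sublist (List.take_sublist _ _)) (hch.take _)
      (fun x hx => hlA x (List.mem_of_mem_take hx)) ?_
    rw [List.length_take]; omega
  have hsmall : ∀ v ∈ A, 2 * #{w ∈ A | G.Adj v w} ≤ r → G.innerDegreeSum A ≤ r * #A := by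
    intro v hv hd
    have e1 := innerDegreeSum_erase (G := G) hv
    have e2 := ih' _ (erase_ssubset hv)
    have e3 : #A = #(A.erase v) + 1 := (card_erase_add_one hv).symm
    rw [e3, mul_add]
    omega
  -- Either the path closes to a cycle, whose vertex set has no edges leaving it and can be split
  -- off, or the end degrees sum to at most `r` and an end of degree at most `r / 2` can be deleted.
  by_cases hdeg : l.length ≤ #{w ∈ A | G.Adj (l.head hne) w} +
      #{w ∈ A | G.Adj (l.getLast hne) w}
  · obtain ⟨c, hcl, hcch, hcyc⟩ := exists_cycle_of_longest hne hnd hch hlA hmax hdeg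
    have hclosed := fun v (hv : v ∈ c) w (hw : w ∈ A) (hvw : G.Adj v w) =>
      mem_of_adj_of_longest_cycle (hcl.nodup_iff.2 hnd) hcch (fun x hx => hlA x (hcl.mem_iff.1 hx))
        hcyc (by rw [hcl.length_eq]; exact hmax) hv hw hvw
    set K := c.toFinset
    have hKA : K ⊆ A := fun x hx => hlA x (hcl.mem_iff.1 (by simpa [K] using hx))
    have hKc : #K = l.length := by
      rw [List.toFinset_card_of_nodup (hcl.nodup_iff.2 hnd), hcl.length_eq]
    have hpos : 0 < l.length := List.length_pos_iff.2 hne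
    have e1 := innerDegreeSum_sdiff_of_closed (G := G) (A := A) (K := K)
      (fun v hv w hw hvw => by
        simpa [K] using hclosed v (by simpa [K] using hv) w hw hvw)
    have e2 := ih' (A \ K) (sdiff_ssubset hKA (card_pos.1 (by omega)))
    -- As `K` has at most `r + 1` vertices, no degree inside it exceeds `r`.
    have e3 : G.innerDegreeSum K ≤ #K * r := by
      rw [innerDegreeSum]
      refine sum_le_card_nsmul _ _ _ fun v hv => ?_
      have : ({w ∈ K | G.Adj v w} : Finset V) ⊆ K.erase v := by
        intro w hw
        rw [mem_filter] at hw
        exact mem_erase.2 ⟨hw.2.ne', hw.1⟩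
      have := card_le_card this
      rw [card_erase_of_mem hv] at this
      omega
    have e4 : #A = #(A \ K) + #K := (card_sdiff_add_card_eq_card hKA).symm
    rw [e4, mul_add, mul_comm r #K]
    omega
  · rcases le_total #{w ∈ A | G.Adj (l.head hne) w} #{w ∈ A | G.Adj (l.getLast hne) w} with hle | hle
    · exact hsmall _ (hlA _ (List.head_mem hne)) (by omega)
    · exact hsmall _ (hlA _ (List.getLast_mem hne)) (by omega)

end SimpleGraph

/-! ### Sparse sets in two-coloured graphs without long paths -/

namespace SimpleGraph

variable {V : Type*} {H : SimpleGraph V} [DecidableEq V]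

/-- Removing pieces around the vertices of `R` one after the other: if every root can be removed
together with a set at a cost bounded by its weight, then so can all roots together. -/
theorem exists_peeling (f : Finset V → ℕ) (wt : V → ℕ) (R A : Finset V)
    (h : ∀ A' ⊆ A, ∀ v ∈ R, v ∈ A' → ∃ K ⊆ A', v ∈ K ∧ f A' ≤ f (A' \ K) + ∑ x ∈ K, wt x) :
    ∃ K ⊆ A, R ∩ A ⊆ K ∧ f A ≤ f (A \ K) + ∑ x ∈ K, wt x := by
  induction A using Finset.strongInduction with
  | H A ih =>
  rcases (R ∩ A).eq_empty_or_nonempty with he | ⟨v, hv⟩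
  · exact ⟨∅, by simp, by simp [he], by simp⟩
  rw [mem_inter] at hv
  obtain ⟨K, hKA, hvK, hK⟩ := h A subset_rfl v hv.1 hv.2
  obtain ⟨K', hKA', hRK', hK'⟩ := ih (A \ K) (sdiff_ssubset hKA ⟨v, hvK⟩)
    fun A' hA' => h A' (hA'.trans sdiff_subset)
  refine ⟨K ∪ K', union_subset hKA (hKA'.trans sdiff_subset), ?_, ?_⟩
  · intro x hx
    rw [mem_inter] at hx
    by_cases hxK : x ∈ K
    · exact mem_union_left _ hxK
    · exact mem_union_right _ (hRK' (mem_inter.2 ⟨hx.1, mem_sdiff.2 ⟨hx.2, hxK⟩⟩))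
  · have hdis : Disjoint K K' := by
      rw [Finset.disjoint_left]
      intro x hx hx'
      exact (mem_sdiff.1 (hKA' hx')).2 hx
    have : A \ (K ∪ K') = (A \ K) \ K' := by
      ext x; simp; tauto
    rw [sum_union hdis, this]
    omega

variable [DecidableRel H.Adj]

/-- If no path with `ℓ` edges starts at `a` in a two-coloured graph, then `a` lies in a set whose
removal destroys few edges: along a depth-first search tree with root `a`, a vertex has at most
`(ℓ - 1) / 2` or `ℓ / 2` ancestors of the other colour. -/
theorem exists_sparse_of_no_path {c : V → Bool} (hc : ∀ v w, H.Adj v w → c v ≠ c w) {ℓ : ℕ}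
    (hℓ : 1 ≤ ℓ) (A : Finset V) (a : V) (ha : a ∈ A)
    (h : ∀ l : List V, (a :: l).Nodup → (a :: l).IsChain H.Adj → (∀ x ∈ l, x ∈ A) →
      l.length ≠ ℓ) :
    ∃ K ⊆ A, a ∈ K ∧ (∀ w ∈ A, H.Adj a w → w ∈ K) ∧
      H.innerDegreeSum A ≤ H.innerDegreeSum (A \ K) +
        ∑ x ∈ K, if c x = c a then 2 * ((ℓ - 1) / 2) else 2 * (ℓ / 2) := by
  induction ℓ, hℓ using Nat.le_induction generalizing A a with
  | base =>
    have h0 : ∀ w ∈ A, ¬ H.Adj a w := fun w hw hadj =>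
      h [w] (by simpa using hadj.ne) (by simpa using hadj) (by simpa using hw) rfl
    refine ⟨{a}, by simpa using ha, by simp, fun w hw hadj => absurd hadj (h0 w hw), ?_⟩
    have e1 := innerDegreeSum_erase (G := H) ha
    rw [filter_eq_empty_iff.2 (fun w hw => h0 w hw), card_empty] at e1
    rw [sdiff_singleton_eq_erase]
    simpa using e1
  | succ ℓ hℓ ih =>
    -- A path with `ℓ` edges from a neighbour of `a`, avoiding `a`, would extend to a forbidden one.
    -- So the neighbours can be peeled off by induction; their colour is opposite to that of `a`,
    -- which swaps the two weights.
    obtain ⟨K, hKA, hRK, hK⟩ := exists_peeling H.innerDegreeSum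
      (fun x => if c x = c a then 2 * (ℓ / 2) else 2 * ((ℓ - 1) / 2))
      {w ∈ A | H.Adj a w} (A.erase a) (by
        intro A' hA' v hv hvA'
        rw [mem_filter] at hv
        obtain ⟨K, hK1, hK2, -, hK3⟩ := ih A' v hvA' (by
          intro l h1 h2 h3 h4
          have hal : a ∉ v :: l := by
            intro hal
            rcases List.mem_cons.1 hal with rfl | hal
            · exact hv.2.ne rfl
            · exact (mem_erase.1 (hA' (h3 a hal))).1 rfl
          refine h (v :: l) (List.nodup_cons.2 ⟨hal, h1⟩) (List.isChain_cons_cons.2 ⟨hv.2, h2⟩) ?_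
            (by simpa using h4)
          intro x hx
          rcases List.mem_cons.1 hx with rfl | hx
          · exact hv.1
          · exact (mem_erase.1 (hA' (h3 x hx))).2)
        refine ⟨K, hK1, hK2, hK3.trans_eq ?_⟩
        congr 1
        refine sum_congr rfl fun x _ => ?_
        have := hc a v hv.2
        have : c x = c v ↔ ¬ c x = c a := by
          revert this
          cases c x <;> cases c v <;> cases c a <;> simp
        by_cases hxa : c x = c a
        · rw [if_pos hxa, if_neg (by rw [this]; simpa using hxa)]
        · rw [if_neg hxa, if_pos (this.2 hxa)])
    have haK : a ∉ K := fun h => (mem_erase.1 (hKA h)).1 rfl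
    refine ⟨insert a K, ?_, mem_insert_self _ _, ?_, ?_⟩
    · exact insert_subset ha (hKA.trans (erase_subset _ _))
    · intro w hw hadj
      exact mem_insert_of_mem (hRK (by simp [hw, hadj, hadj.ne']))
    · have e1 := innerDegreeSum_erase (G := H) ha
      -- The degree of `a` is charged to the vertices of `K` of the other colour, which contain all
      -- its neighbours. Their weight grows by exactly 2, from `2 * ((ℓ - 1) / 2)` to `2 * ((ℓ + 1)
      -- / 2)`.
      have e2 : #{w ∈ A | H.Adj a w} ≤ ∑ x ∈ K, if c x = c a then 0 else 1 := by
        have e0 : ∑ x ∈ K, (if c x = c a then 0 else 1) = #{x ∈ K | ¬ c x = c a} := by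
          rw [card_filter]
          exact sum_congr rfl fun x _ => by split_ifs <;> rfl
        rw [e0]
        refine card_le_card fun w hw => ?_
        rw [mem_filter] at hw
        exact mem_filter.2 ⟨hRK (by simp [hw.1, hw.2, hw.2.ne']), (hc a w hw.2).symm⟩
      have e3 : A \ insert a K = A.erase a \ K := by
        ext x; simp; tauto
      have e4 : ∑ x ∈ K, (if c x = c a then 2 * ((ℓ + 1 - 1) / 2) else 2 * ((ℓ + 1) / 2)) =
          ∑ x ∈ K, (if c x = c a then 2 * (ℓ / 2) else 2 * ((ℓ - 1) / 2)) +
            2 * ∑ x ∈ K, if c x = c a then 0 else 1 := by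
        rw [mul_sum, ← sum_add_distrib]
        refine sum_congr rfl fun x _ => ?_
        split_ifs
        · simp
        · omega
      rw [sum_insert haK, e3, e4]
      omega

/-- Variant of `exists_sparse_of_no_path` for paths that avoid a set `S`. -/
theorem exists_sparse_of_no_path_avoiding {c : V → Bool} (hc : ∀ v w, H.Adj v w → c v ≠ c w)
    {ℓ : ℕ} (hℓ : 1 ≤ ℓ) (A S : Finset V) (a : V) (ha : a ∈ A) (haS : a ∉ S)
    (h : ∀ l : List V, (a :: l).Nodup → (a :: l).IsChain H.Adj → (∀ x ∈ l, x ∈ A ∧ x ∉ S) →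
      l.length ≠ ℓ) :
    ∃ K ⊆ A \ S, a ∈ K ∧ (∀ w ∈ A \ S, H.Adj a w → w ∈ K) ∧
      H.innerDegreeSum A ≤ H.innerDegreeSum (A \ K) +
        ∑ x ∈ K, ((if c x = c a then 2 * ((ℓ - 1) / 2) else 2 * (ℓ / 2)) +
          2 * #{s ∈ S | c s ≠ c x}) := by
  obtain ⟨K, hKA, haK, hnK, hK⟩ := exists_sparse_of_no_path hc hℓ (A \ S) a
    (mem_sdiff.2 ⟨ha, haS⟩) (fun l h1 h2 h3 => h l h1 h2 fun x hx => mem_sdiff.1 (h3 x hx))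
  refine ⟨K, hKA, haK, hnK, ?_⟩
  rw [sum_add_distrib, ← mul_sum]
  simp only [innerDegreeSum_eq_card] at hK ⊢
  set P : Finset V → Finset (V × V) := fun A => {p ∈ A ×ˢ A | H.Adj p.1 p.2} with hP
  set Q : Finset (V × V) := {p ∈ K ×ˢ S | c p.2 ≠ c p.1} with hQ
  have hQc : #Q = ∑ x ∈ K, #{s ∈ S | c s ≠ c x} := by
    rw [hQ, card_filter, sum_product]
    exact sum_congr rfl fun v _ => (card_filter _ _).symm
  change #(P (A \ S)) ≤ #(P ((A \ S) \ K)) + _ at hK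
  change #(P A) ≤ #(P (A \ K)) + _
  -- A pair destroyed by removing `K` either avoids `S` or joins `K` to `S`; the latter occur in
  -- both orders and only between different colours.
  have hsub : P A ⊆ P (A \ K) ∪ ((P (A \ S) \ P ((A \ S) \ K)) ∪ (Q ∪ Q.image Prod.swap)) := by
    rintro ⟨x, y⟩ hxy
    simp only [hP, mem_filter, mem_product] at hxy
    have hcxy := hc x y hxy.2
    by_cases h1 : x ∈ S
    · have hxK : x ∉ K := fun hx => (mem_sdiff.1 (hKA hx)).2 h1
      by_cases h2 : y ∈ K
      · refine mem_union_right _ (mem_union_right _ (mem_union_right _ ?_))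
        exact mem_image.2 ⟨(y, x), by simp [hQ, h1, h2, hcxy], rfl⟩
      · exact mem_union_left _ (by simp [hP, hxy, hxK, h2])
    by_cases h2 : y ∈ S
    · have hyK : y ∉ K := fun hy => (mem_sdiff.1 (hKA hy)).2 h2
      by_cases h3 : x ∈ K
      · refine mem_union_right _ (mem_union_right _ (mem_union_left _ ?_))
        simp [hQ, h2, h3, hcxy.symm]
      · exact mem_union_left _ (by simp [hP, hxy, hyK, h3])
    by_cases h3 : x ∈ K ∨ y ∈ K
    · refine mem_union_right _ (mem_union_left _ ?_)
      simp only [hP, mem_sdiff, mem_filter, mem_product, not_and]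
      tauto
    · push Not at h3
      exact mem_union_left _ (by simp [hP, hxy, h3])
  have e1 := card_le_card hsub
  have e2 := card_union_le (P (A \ K)) ((P (A \ S) \ P ((A \ S) \ K)) ∪ (Q ∪ Q.image Prod.swap))
  have e3 := card_union_le (P (A \ S) \ P ((A \ S) \ K)) (Q ∪ Q.image Prod.swap)
  have e4 := card_union_le Q (Q.image Prod.swap)
  have e5 := card_image_le (s := Q) (f := Prod.swap)
  have e6 : P ((A \ S) \ K) ⊆ P (A \ S) := fun p hp => by
    simp only [hP, mem_filter, mem_product, mem_sdiff] at hp ⊢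
    tauto
  have e7 := card_sdiff_add_card_eq_card e6
  omega

end SimpleGraph

/-! ### The bipartite graph between `N` and `W` -/

namespace SimpleGraph

variable {V : Type*}

/-- The bipartite graph of the edges of `G` between the neighbours of `u` and the remaining
vertices other than `u`. -/
def crossGraph (G : SimpleGraph V) (u : V) : SimpleGraph V where
  Adj v w := v ≠ u ∧ w ≠ u ∧ G.Adj v w ∧ ¬(G.Adj u v ↔ G.Adj u w)
  symm := ⟨fun _ _ h => ⟨h.2.1, h.1, h.2.2.1.symm, fun h' => h.2.2.2 h'.symm⟩⟩
  loopless := ⟨fun _ h => h.2.2.2 Iff.rfl⟩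

variable {G : SimpleGraph V} {u : V}

theorem isChain_of_crossGraph {l : List V} (h : l.IsChain (G.crossGraph u).Adj) :
    l.IsChain G.Adj := h.imp fun _ _ h => h.2.2.1

theorem notMem_of_isChain_crossGraph {a : V} {l : List V}
    (h : (a :: l).IsChain (G.crossGraph u).Adj) : u ∉ l := by
  induction l generalizing a with
  | nil => simp
  | cons b l ih =>
    rw [List.isChain_cons_cons] at h
    rw [List.mem_cons, not_or]
    exact ⟨h.1.2.1.symm, ih h.2⟩

/-- Each edge changes sides, so the parity of the length decides whether a path starting in `N` ends
in `N`. This is the source of the distinction between even and odd `r`. -/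
theorem adj_iff_even_of_isChain_crossGraph {a x : V} {l : List V}
    (h : (a :: l).IsChain (G.crossGraph u).Adj) (ha : G.Adj u a) (hx : x ∈ (a :: l).getLast?) :
    G.Adj u x ↔ Even l.length := by
  suffices H : ∀ (l : List V) (a : V), (a :: l).IsChain (G.crossGraph u).Adj →
      x ∈ (a :: l).getLast? → (G.Adj u x ↔ (G.Adj u a ↔ Even l.length)) by
    have := H l a h hx
    tauto
  intro l
  induction l with
  | nil =>
    intro a _ hx
    simp only [List.getLast?_singleton, Option.mem_def, Option.some.injEq] at hx
    subst hx
    simp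
  | cons b l ih =>
    intro a h hx
    rw [List.isChain_cons_cons] at h
    rw [List.getLast?_cons_cons] at hx
    have e1 := ih b h.2 hx
    have e2 := h.1.2.2.2
    rw [List.length_cons, Nat.even_add_one]
    tauto

variable [DecidableRel G.Adj] {N W : Finset V}

theorem innerDegreeSum_eq_two_mul {H : SimpleGraph V} [DecidableRel H.Adj] {c : V → Bool}
    (hc : ∀ v w, H.Adj v w → c v ≠ c w) (A : Finset V) :
    H.innerDegreeSum A = 2 * ∑ v ∈ A with c v = true, #{w ∈ A | H.Adj v w} := by
  have e1 := sum_filter_add_sum_filter_not A (fun v => c v = true) fun v => #{w ∈ A | H.Adj v w}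
  have e2 := sum_card_bipartiteAbove_eq_sum_card_bipartiteBelow (s := {v ∈ A | c v = true})
    (t := {v ∈ A | ¬ c v = true}) H.Adj
  have e3 : ∑ v ∈ A with c v = true, #{w ∈ A | H.Adj v w} =
      ∑ v ∈ A with c v = true, #(bipartiteAbove H.Adj {v ∈ A | ¬ c v = true} v) := by
    refine sum_congr rfl fun v hv => congrArg card ?_
    ext w
    have := hc v w
    simp only [mem_filter, bipartiteAbove] at hv ⊢
    rw [hv.2] at this
    constructor
    · exact fun h => ⟨⟨h.1, (this h.2).symm⟩, h.2⟩
    · exact fun h => ⟨h.1.1, h.2⟩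
  have e4 : ∑ v ∈ A with ¬ c v = true, #{w ∈ A | H.Adj v w} =
      ∑ v ∈ A with ¬ c v = true, #(bipartiteBelow H.Adj {v ∈ A | c v = true} v) := by
    refine sum_congr rfl fun v hv => congrArg card ?_
    ext w
    have := hc v w
    simp only [mem_filter, bipartiteBelow, Bool.not_eq_true] at hv ⊢
    rw [hv.2] at this
    constructor
    · intro h
      exact ⟨⟨h.1, by simpa using (this h.2).symm⟩, h.2.symm⟩
    · exact fun h => ⟨h.1.1, h.2.symm⟩
  rw [innerDegreeSum]
  omega

theorem crossGraph_colour_ne (v w : V) (h : (G.crossGraph u).Adj v w) :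
    decide (G.Adj u v) ≠ decide (G.Adj u w) := by
  simpa using h.2.2.2

variable [DecidableEq V]

theorem innerDegreeSum_crossGraph [DecidableRel (G.crossGraph u).Adj]
    (hN : ∀ v, v ∈ N ↔ G.Adj u v) (hW : ∀ v, v ∈ W ↔ v ≠ u ∧ ¬ G.Adj u v) {A : Finset V} (hA : u ∉ A) :
    (G.crossGraph u).innerDegreeSum A = 2 * ∑ v ∈ N ∩ A, #{w ∈ W ∩ A | G.Adj v w} := by
  rw [innerDegreeSum_eq_two_mul crossGraph_colour_ne]
  have e : ({v ∈ A | decide (G.Adj u v) = true} : Finset V) = N ∩ A := by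
    ext v; simp [hN, and_comm]
  rw [e]
  congr 1
  refine sum_congr rfl fun v hv => congrArg card ?_
  ext w
  simp only [mem_inter, hN] at hv
  have hvu : v ≠ u := fun h => hA (h ▸ hv.2)
  rw [mem_filter, mem_filter, mem_inter, hW]
  change w ∈ A ∧ (v ≠ u ∧ w ≠ u ∧ G.Adj v w ∧ ¬(G.Adj u v ↔ G.Adj u w)) ↔ _
  have : w ∈ A → w ≠ u := fun h h' => hA (h' ▸ h)
  tauto

theorem innerDegreeSum_crossGraph_le [DecidableRel (G.crossGraph u).Adj]
    (hN : ∀ v, v ∈ N ↔ G.Adj u v) (hW : ∀ v, v ∈ W ↔ v ≠ u ∧ ¬ G.Adj u v) {A : Finset V} (hA : u ∉ A) :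
    (G.crossGraph u).innerDegreeSum A ≤ 2 * (#(N ∩ A) * #(W ∩ A)) := by
  rw [innerDegreeSum_crossGraph hN hW hA]
  exact Nat.mul_le_mul_left _ (sum_le_card_nsmul _ _ _ fun v _ => card_filter_le _ _)

variable [Fintype V]

/-- If every vertex of `R` starts no path with `ℓ` edges in the bipartite graph between `N` and `W`
without few vertices of `N`, then there are few edges between `N` and `W` at a set containing
`R`. -/
theorem exists_superset_of_no_path (hN : ∀ v, v ∈ N ↔ G.Adj u v)
    (hW : ∀ v, v ∈ W ↔ v ≠ u ∧ ¬ G.Adj u v) {ℓ t : ℕ} (hℓ : 1 ≤ ℓ) {R : Finset V} (hRN : R ⊆ N)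
    (hR : ∀ v ∈ R, ∃ S ⊆ N, #S ≤ t ∧ v ∉ S ∧ ∀ l : List V, (v :: l).Nodup →
      (v :: l).IsChain (G.crossGraph u).Adj → (∀ x ∈ l, x ∉ S) → l.length ≠ ℓ) :
    ∃ K, R ⊆ K ∧ ∑ v ∈ N, #{w ∈ W | G.Adj v w} ≤
      #(N \ K) * #(W \ K) + (ℓ - 1) / 2 * #(N ∩ K) + (ℓ / 2 + t) * #(W ∩ K) := by
  classical
  set A : Finset V := univ.erase u with hA
  have hNA : N ⊆ A := fun v hv => by simpa [A] using ((hN v).1 hv).ne'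
  have hWA : W ⊆ A := fun v hv => by simpa [A] using ((hW v).1 hv).1
  have huA : u ∉ A := by simp [A]
  obtain ⟨K, hKA, hRK, hK⟩ := exists_peeling (G.crossGraph u).innerDegreeSum
    (fun x => if G.Adj u x then 2 * ((ℓ - 1) / 2) else 2 * (ℓ / 2 + t)) R A (by
      intro A' hA' v hv hvA'
      obtain ⟨S, hSN, hSt, hvS, hS⟩ := hR v hv
      obtain ⟨K, hK1, hK2, -, hK3⟩ := exists_sparse_of_no_path_avoiding
        (crossGraph_colour_ne (G := G) (u := u)) hℓ A' S v hvA' hvS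
        fun l h1 h2 h3 => hS l h1 h2 fun x hx => (h3 x hx).2
      refine ⟨K, hK1.trans sdiff_subset, hK2, hK3.trans ?_⟩
      -- Since `S ⊆ N`, only vertices of `W` pay for edges to `S`.
      refine Nat.add_le_add_left (sum_le_sum fun x _ => ?_) _
      have hv' : G.Adj u v := (hN v).1 (hRN hv)
      by_cases hx : G.Adj u x
      · have : ({s ∈ S | decide (G.Adj u s) ≠ decide (G.Adj u x)} : Finset V) = ∅ := by
          refine filter_eq_empty_iff.2 fun s hs => ?_
          simp [hx, (hN s).1 (hSN hs)]
        rw [this]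
        simp [hx, hv']
      · have := card_filter_le S (fun s => decide (G.Adj u s) ≠ decide (G.Adj u x))
        simp only [hx, hv', if_false, decide_true, decide_false, Bool.false_eq_true] at this ⊢
        omega)
  refine ⟨K, fun v hv => hRK (mem_inter.2 ⟨hv, hNA (hRN hv)⟩), ?_⟩
  have e1 := innerDegreeSum_crossGraph hN hW huA
  have e2 := innerDegreeSum_crossGraph_le (A := A \ K) hN hW (by simp [A])
  rw [inter_eq_left.2 hNA, inter_eq_left.2 hWA] at e1
  have e3 : N ∩ (A \ K) = N \ K := by
    ext x; have := @hNA x; simp only [mem_inter, mem_sdiff]; tauto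
  have e4 : W ∩ (A \ K) = W \ K := by
    ext x; have := @hWA x; simp only [mem_inter, mem_sdiff]; tauto
  rw [e3, e4] at e2
  have e5 : ∑ x ∈ K, (if G.Adj u x then 2 * ((ℓ - 1) / 2) else 2 * (ℓ / 2 + t)) =
      2 * ((ℓ - 1) / 2 * #(N ∩ K)) + 2 * ((ℓ / 2 + t) * #(W ∩ K)) := by
    rw [sum_ite, sum_const, sum_const]
    have f1 : ({x ∈ K | G.Adj u x} : Finset V) = N ∩ K := by
      ext x; simp [hN, and_comm]
    have f2 : ({x ∈ K | ¬ G.Adj u x} : Finset V) = W ∩ K := by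
      ext x
      have : x ∈ K → x ≠ u := fun h h' => huA (hKA (h' ▸ h))
      simp only [mem_filter, mem_inter, hW]; tauto
    rw [f1, f2]
    simp only [smul_eq_mul]
    ring
  omega

end SimpleGraph

/-! ### Degree sums over a neighbourhood: even `r` -/

namespace SimpleGraph

variable {V : Type*} {G : SimpleGraph V} {u : V} {N W : Finset V}

theorem not_isChain_neighbors {r : ℕ} (hG : (generalizedTheta ![1, 2, r + 1]).Free G)
    (l : List V) (hnd : l.Nodup) (hch : l.IsChain G.Adj) (hlN : ∀ x ∈ l, G.Adj u x) :
    l.length ≠ r + 2 := by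
  intro hlen
  match l, hlen with
  | a :: b :: l, hlen =>
    refine not_isChain_of_theta_free hG (u := u) (by simpa using hlen) hnd hch ?_
      (hlN a (by simp)) (hlN b (by simp)) ?_
    · exact fun h => (hlN u (by simp [h])).ne rfl
    · exact fun x hx => hlN x (by simp [List.mem_of_getLast? (Option.mem_def.1 hx)])

variable [DecidableRel G.Adj]

/-- Discarding isolated vertices of `N` lets Erdős–Gallai give `r * #L` in place of `r * #N`. -/
theorem innerDegreeSum_le_of_support {L : Finset V}
    (hL : ∀ v ∈ N, ∀ w ∈ N, G.Adj v w → v ∈ L) : G.innerDegreeSum N ≤ G.innerDegreeSum L := by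
  simp only [innerDegreeSum_eq_card]
  refine card_le_card fun p hp => ?_
  simp only [mem_filter, mem_product] at hp ⊢
  exact ⟨⟨hL _ hp.1.1 _ hp.1.2 hp.2, hL _ hp.1.2 _ hp.1.1 hp.2.symm⟩, hp.2⟩

variable [DecidableEq V] [Fintype V]

theorem card_add_card_add_one (hN : ∀ v, v ∈ N ↔ G.Adj u v)
    (hW : ∀ v, v ∈ W ↔ v ≠ u ∧ ¬ G.Adj u v) : #N + #W + 1 = Fintype.card V := by
  have h1 : Disjoint N W := by
    rw [Finset.disjoint_left]
    intro v hv hv'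
    exact ((hW v).1 hv').2 ((hN v).1 hv)
  have h2 : N ∪ W = univ.erase u := by
    ext v
    have : G.Adj u v → v ≠ u := fun h => h.ne'
    simp only [mem_union, hN, hW, mem_erase, mem_univ]
    tauto
  rw [← card_union_of_disjoint h1, h2, card_erase_add_one (mem_univ _), card_univ]

theorem sum_degree_neighbors (hN : ∀ v, v ∈ N ↔ G.Adj u v)
    (hW : ∀ v, v ∈ W ↔ v ≠ u ∧ ¬ G.Adj u v) :
    ∑ v ∈ N, G.degree v = #N + G.innerDegreeSum N + ∑ v ∈ N, #{w ∈ W | G.Adj v w} := by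
  rw [innerDegreeSum, card_eq_sum_ones, ← sum_add_distrib, ← sum_add_distrib]
  refine sum_congr rfl fun v hv => ?_
  have hvu : G.Adj v u := ((hN v).1 hv).symm
  have h1 : Disjoint ({w ∈ N | G.Adj v w} : Finset V) {w ∈ W | G.Adj v w} := by
    rw [Finset.disjoint_left]
    intro x hx hx'
    exact ((hW x).1 (mem_filter.1 hx').1).2 ((hN x).1 (mem_filter.1 hx).1)
  have h2 : G.neighborFinset v = insert u ({w ∈ N | G.Adj v w} ∪ {w ∈ W | G.Adj v w}) := by
    ext w
    have : G.Adj u w → w ≠ u := fun h => h.ne'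
    simp only [mem_neighborFinset, mem_insert, mem_union, mem_filter, hN, hW]
    by_cases hw : w = u
    · subst hw; simp [hvu]
    · tauto
  rw [← card_neighborFinset_eq_degree, h2, card_insert_of_notMem, card_union_of_disjoint h1]
  · omega
  · simp [hN, hW]

/-- For an edge `wv` inside `N`, an alternating path with `r = 2 * s` edges from `v` ends in `N`;
preceded by `w` it is a forbidden path on `r + 2` vertices. Hence every non-isolated vertex of `N`
can be put into the sparse set `K`. -/
theorem sum_degree_lt_of_even {s : ℕ} (hs : 1 ≤ s) (hn : 14 * s ≤ Fintype.card V)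
    (hG : (generalizedTheta ![1, 2, 2 * s + 1]).Free G) (hN : ∀ v, v ∈ N ↔ G.Adj u v)
    (hW : ∀ v, v ∈ W ↔ v ≠ u ∧ ¬ G.Adj u v) {a b : V} (ha : a ∈ N) (hb : b ∈ N)
    (hab : G.Adj a b) : 4 * ∑ v ∈ N, G.degree v + 1 < Fintype.card V ^ 2 := by
  set L : Finset V := {v ∈ N | ∃ w ∈ N, G.Adj v w} with hL
  have hLN : L ⊆ N := filter_subset _ _
  obtain ⟨K, hLK, hK⟩ := exists_superset_of_no_path hN hW (ℓ := 2 * s) (t := 1) (by omega) hLN (by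
    intro v hv
    rw [mem_filter] at hv
    obtain ⟨hvN, w, hwN, hvw⟩ := hv
    refine ⟨{w}, by simpa using hwN, by simp, by simpa using hvw.ne, ?_⟩
    intro l hnd hch hl hlen
    have hch' := isChain_of_crossGraph hch
    refine not_isChain_of_theta_free hG (u := u) (a := w) (b := v) hlen ?_
      (List.isChain_cons_cons.2 ⟨hvw.symm, hch'⟩) (notMem_of_isChain_crossGraph hch)
      ((hN w).1 hwN) ((hN v).1 hvN) ?_
    · rw [List.nodup_cons]
      refine ⟨?_, hnd⟩
      rw [List.mem_cons, not_or]
      exact ⟨hvw.ne', fun h => hl w h (by simp)⟩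
    · intro x hx
      refine (adj_iff_even_of_isChain_crossGraph hch ((hN v).1 hvN) ?_).2 (by simp [hlen])
      rw [List.getLast?_cons, Option.mem_def.1 hx]
      rfl)
  have e1 := innerDegreeSum_le_of_support (G := G) (N := N) (L := L) fun v hv w hw hvw => by
    rw [hL, mem_filter]; exact ⟨hv, w, hw, hvw⟩
  have e2 := innerDegreeSum_le_of_no_path (G := G) (r := 2 * s) L fun l h1 h2 h3 =>
    not_isChain_neighbors hG l h1 h2 fun x hx => (hN x).1 (hLN (h3 x hx))
  have e3 : #L ≤ #(N ∩ K) := card_le_card fun x hx => mem_inter.2 ⟨hLN hx, hLK hx⟩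
  have e4 : 1 ≤ #L := card_pos.2 ⟨a, by rw [hL, mem_filter]; exact ⟨ha, b, hb, hab⟩⟩
  have e5 := card_add_card_add_one hN hW
  have e6 := sum_degree_neighbors hN hW
  have e7 := card_inter_add_card_sdiff N K
  have e8 := card_inter_add_card_sdiff W K
  obtain ⟨s, rfl⟩ : ∃ k, s = k + 1 := ⟨s - 1, by omega⟩
  have e9 : (2 * (s + 1) - 1) / 2 = s := by omega
  have e10 : (2 * (s + 1)) / 2 = s + 1 := by omega
  rw [e9, e10] at hK
  generalize #(N ∩ K) = p₁ at *
  generalize #(N \ K) = q₁ at *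
  generalize #(W ∩ K) = p₂ at *
  generalize #(W \ K) = q₂ at *
  have e11 := Nat.mul_le_mul_left (2 * (s + 1)) e3
  -- With `r = 2 * (s + 1)` after the shift, a vertex of `N ∩ K` costs 1 for `u`, `r` inside `N` and
  -- `s` towards `W`, in total `3 * (s + 1)`; a vertex of `W ∩ K` costs `s + 2`, which is no more.
  have b1 : ∑ v ∈ N, G.degree v ≤ q₁ * (q₂ + 1) + 3 * (s + 1) * (p₁ + p₂) := by
    rw [e6, ← e7]
    nlinarith
  have hp : 1 ≤ p₁ + p₂ := by omega
  have hcard : Fintype.card V = q₁ + q₂ + 1 + (p₁ + p₂) := by omega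
  rw [hcard] at hn ⊢
  generalize p₁ + p₂ = p at *
  -- By AM–GM `4 * q₁ * (q₂ + 1) ≤ (n - p)²`, and `n² - (n - p)² ≥ p * n ≥ 14 * (s + 1) * p`, which
  -- beats `12 * (s + 1) * p + 1`.
  have := Nat.mul_le_mul_left p hn
  zify at *
  nlinarith [sq_nonneg ((q₁ : ℤ) - (q₂ + 1))]

end SimpleGraph

/-! ### Degree sums over a neighbourhood: odd `r` -/

namespace SimpleGraph

variable {V : Type*} {G : SimpleGraph V} {u : V} {N W : Finset V} [DecidableRel G.Adj]

/-- In a matching, the degree sum is small unless some edge of the matching is joined to almost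
all of `W`. -/
theorem two_mul_sum_le_of_matching (hmat : ∀ v ∈ N, #{w ∈ N | G.Adj v w} ≤ 1) {m : ℕ}
    (hpair : ∀ a ∈ N, ∀ b ∈ N, G.Adj a b →
      #{w ∈ W | G.Adj a w} + #{w ∈ W | G.Adj b w} + m ≤ 2 * #W) :
    2 * (G.innerDegreeSum N + ∑ v ∈ N, #{w ∈ W | G.Adj v w}) + m * G.innerDegreeSum N ≤
      2 * #N * #W + 2 * G.innerDegreeSum N := by
  have h1 : ∑ v ∈ N, ∑ w ∈ N with G.Adj v w, (#{x ∈ W | G.Adj v x} + #{x ∈ W | G.Adj w x} + m) ≤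
      ∑ v ∈ N, ∑ w ∈ N with G.Adj v w, 2 * #W :=
    sum_le_sum fun v hv => sum_le_sum fun w hw =>
      hpair v hv w (mem_filter.1 hw).1 (mem_filter.1 hw).2
  have h2 : ∑ v ∈ N, ∑ w ∈ N with G.Adj v w, #{x ∈ W | G.Adj w x} =
      ∑ v ∈ N, ∑ w ∈ N with G.Adj v w, #{x ∈ W | G.Adj v x} := by
    simp only [sum_filter]
    rw [sum_comm]
    exact sum_congr rfl fun v _ => sum_congr rfl fun w _ => by simp only [G.adj_comm]
  simp only [sum_add_distrib] at h1
  rw [h2] at h1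
  simp only [sum_const, smul_eq_mul] at h1
  rw [← sum_mul, ← sum_mul] at h1
  change _ + _ + G.innerDegreeSum N * m ≤ G.innerDegreeSum N * _ at h1
  -- The degree of `v` inside `N` is 0 or 1: unmatched vertices only need the trivial bound `#W`,
  -- and for matched ones this is an equality. The product term on the right is controlled by `h1`.
  have h3 : ∑ v ∈ N, 2 * (#{w ∈ N | G.Adj v w} + #{w ∈ W | G.Adj v w} +
      #{w ∈ N | G.Adj v w} * #W) ≤
      ∑ v ∈ N, (2 * #W + 2 * #{w ∈ N | G.Adj v w} +
        2 * (#{w ∈ N | G.Adj v w} * #{w ∈ W | G.Adj v w})) := by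
    refine sum_le_sum fun v hv => ?_
    have e1 := hmat v hv
    have e2 : #{w ∈ W | G.Adj v w} ≤ #W := card_filter_le _ _
    interval_cases h : #{w ∈ N | G.Adj v w} <;> omega
  simp only [sum_add_distrib, ← mul_sum, sum_const, smul_eq_mul] at h3
  rw [← sum_mul] at h3
  change 2 * (G.innerDegreeSum N + _ + G.innerDegreeSum N * #W) ≤
    _ + 2 * G.innerDegreeSum N + _ at h3
  nlinarith

variable [DecidableEq V]

/-- Erdős–Gallai bound that separates the ends `R` of three-vertex paths from the other vertices,
which are isolated, in isolated edges, or centres of stars. -/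
theorem innerDegreeSum_le_of_no_path_of_three_path {r : ℕ} (hr : 2 ≤ r) {R : Finset V}
    (hR : ∀ v, v ∈ R ↔ v ∈ N ∧ ∃ x ∈ N, ∃ y ∈ N, x ≠ v ∧ G.Adj x y ∧ G.Adj y v)
    (h : ∀ l : List V, l.Nodup → l.IsChain G.Adj → (∀ x ∈ l, x ∈ N) → l.length ≠ r + 2) :
    G.innerDegreeSum N ≤ r * #R + #(N \ R) := by
  have hRN : R ⊆ N := fun v hv => ((hR v).1 hv).1
  -- A second neighbour of `b` would make `v` the end of a three-vertex path. So vertices of `R₁`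
  -- are leaves of stars; each accounts for two ordered pairs, within the budget as `r ≥ 2`.
  have huniq : ∀ v ∈ N \ R, ∀ b ∈ N, G.Adj b v → ∀ x ∈ N, G.Adj b x → x = v := by
    intro v hv b hb hbv x hx hbx
    by_contra hne
    rw [mem_sdiff] at hv
    exact hv.2 ((hR v).2 ⟨hv.1, x, hx, b, hb, hne, hbx.symm, hbv⟩)
  set R₁ : Finset V := {b ∈ R | ∃ v ∈ N \ R, G.Adj b v} with hR₁
  have hR₁R : R₁ ⊆ R := filter_subset _ _
  set Q : Finset (V × V) := {p ∈ R₁ ×ˢ N | G.Adj p.1 p.2}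
  set T : Finset (V × V) := {p ∈ (N \ R) ×ˢ (N \ R) | G.Adj p.1 p.2}
  have hQ : #Q ≤ #R₁ := by
    rw [card_filter, sum_product, card_eq_sum_ones]
    refine sum_le_sum fun b hb => ?_
    rw [hR₁, mem_filter] at hb
    obtain ⟨hbR, v, hv, hbv⟩ := hb
    rw [← card_filter, card_le_one]
    intro x hx y hy
    rw [mem_filter] at hx hy
    rw [huniq v hv b (hRN hbR) hbv x hx.1 hx.2, huniq v hv b (hRN hbR) hbv y hy.1 hy.2]
  have hT : #T ≤ #(N \ R) := by
    rw [card_filter, sum_product, card_eq_sum_ones]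
    refine sum_le_sum fun b hb => ?_
    rw [← card_filter, card_le_one]
    intro x hx y hy
    rw [mem_filter] at hx hy
    exact (huniq x hx.1 b (mem_sdiff.1 hb).1 hx.2 y (mem_sdiff.1 hy.1).1 hy.2).symm
  have hEG := innerDegreeSum_le_of_no_path (G := G) (r := r) (R \ R₁) fun l h1 h2 h3 =>
    h l h1 h2 fun x hx => hRN (mem_sdiff.1 (h3 x hx)).1
  rw [innerDegreeSum_eq_card] at hEG ⊢
  set P : Finset (V × V) := {p ∈ (R \ R₁) ×ˢ (R \ R₁) | G.Adj p.1 p.2}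
  have hsub : ({p ∈ N ×ˢ N | G.Adj p.1 p.2} : Finset (V × V)) ⊆
      P ∪ ((Q ∪ Q.image Prod.swap) ∪ T) := by
    rintro ⟨x, y⟩ hxy
    simp only [mem_filter, mem_product] at hxy
    obtain ⟨⟨hx, hy⟩, hadj⟩ := hxy
    by_cases h1 : x ∈ R₁
    · exact mem_union_right _ (mem_union_left _ (mem_union_left _
        (mem_filter.2 ⟨mem_product.2 ⟨h1, hy⟩, hadj⟩)))
    by_cases h2 : y ∈ R₁
    · exact mem_union_right _ (mem_union_left _ (mem_union_right _ (mem_image.2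
        ⟨(y, x), mem_filter.2 ⟨mem_product.2 ⟨h2, hx⟩, hadj.symm⟩, rfl⟩)))
    by_cases h3 : x ∈ R
    · have h4 : y ∈ R := by
        by_contra h4
        exact h1 (mem_filter.2 ⟨h3, y, mem_sdiff.2 ⟨hy, h4⟩, hadj⟩)
      exact mem_union_left _ (mem_filter.2
        ⟨mem_product.2 ⟨mem_sdiff.2 ⟨h3, h1⟩, mem_sdiff.2 ⟨h4, h2⟩⟩, hadj⟩)
    · have h4 : y ∉ R := by
        intro h4
        exact h2 (mem_filter.2 ⟨h4, x, mem_sdiff.2 ⟨hx, h3⟩, hadj.symm⟩)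
      exact mem_union_right _ (mem_union_right _ (mem_filter.2
        ⟨mem_product.2 ⟨mem_sdiff.2 ⟨hx, h3⟩, mem_sdiff.2 ⟨hy, h4⟩⟩, hadj⟩))
  have e1 := card_le_card hsub
  have e2 := card_union_le P ((Q ∪ Q.image Prod.swap) ∪ T)
  have e3 := card_union_le (Q ∪ Q.image Prod.swap) T
  have e4 := card_union_le Q (Q.image Prod.swap)
  have e5 := card_image_le (s := Q) (f := Prod.swap)
  have e6 := card_sdiff_add_card_eq_card hR₁R
  have e7 : 2 * #R₁ ≤ r * #R₁ := Nat.mul_le_mul_right _ hr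
  rw [← e6, mul_add]
  omega

variable [Fintype V]

/-- An alternating path that starts and ends in `N` has even length, so for odd `r` two vertices of
`N` must precede the `N` vertex it starts from: a path `x y v` in `N` followed by `2 * s`
alternating edges has `r + 2` vertices. -/
theorem sum_degree_lt_of_odd_of_three_path {s : ℕ} (hs : 1 ≤ s)
    (hn : 10 * (2 * s + 1) ≤ Fintype.card V)
    (hG : (generalizedTheta ![1, 2, 2 * s + 1 + 1]).Free G) (hN : ∀ v, v ∈ N ↔ G.Adj u v)
    (hW : ∀ v, v ∈ W ↔ v ≠ u ∧ ¬ G.Adj u v) {a b c : V} (ha : a ∈ N) (hb : b ∈ N) (hc : c ∈ N)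
    (hac : a ≠ c) (hab : G.Adj a b) (hbc : G.Adj b c) :
    4 * ∑ v ∈ N, G.degree v + 1 < Fintype.card V ^ 2 := by
  set R : Finset V := {v ∈ N | ∃ x ∈ N, ∃ y ∈ N, x ≠ v ∧ G.Adj x y ∧ G.Adj y v} with hR
  have hRN : R ⊆ N := filter_subset _ _
  obtain ⟨K, hRK, hK⟩ := exists_superset_of_no_path hN hW (ℓ := 2 * s) (t := 2) (by omega) hRN (by
    intro v hv
    rw [mem_filter] at hv
    obtain ⟨hvN, x, hxN, y, hyN, hxv, hxy, hyv⟩ := hv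
    refine ⟨{x, y}, by simp [insert_subset_iff, hxN, hyN], card_le_two, ?_, ?_⟩
    · simp [hxv.symm, hyv.ne']
    intro l hnd hch hl hlen
    have hch' := isChain_of_crossGraph hch
    have hxl : x ∉ l := fun h => hl x h (by simp)
    have hyl : y ∉ l := fun h => hl y h (by simp)
    refine not_isChain_of_theta_free hG (u := u) (a := x) (b := y) (l := v :: l) (by simp [hlen]) ?_
      (List.isChain_cons_cons.2 ⟨hxy, List.isChain_cons_cons.2 ⟨hyv, hch'⟩⟩) ?_
      ((hN x).1 hxN) ((hN y).1 hyN) ?_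
    · rw [List.nodup_cons, List.nodup_cons]
      simp only [List.mem_cons, not_or]
      exact ⟨⟨hxy.ne, hxv, hxl⟩, ⟨hyv.ne, hyl⟩, hnd⟩
    · rw [List.mem_cons, not_or]
      exact ⟨((hN v).1 hvN).ne, notMem_of_isChain_crossGraph hch⟩
    · intro z hz
      exact (adj_iff_even_of_isChain_crossGraph hch ((hN v).1 hvN) hz).2 (by simp [hlen]))
  have e1 := innerDegreeSum_le_of_no_path_of_three_path (G := G) (r := 2 * s + 1) (N := N) (R := R)
    (by omega) (fun v => by rw [hR, mem_filter]) fun l h1 h2 h3 =>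
      not_isChain_neighbors hG l h1 h2 fun x hx => (hN x).1 (h3 x hx)
  have e3 : #R ≤ #(N ∩ K) := card_le_card fun x hx => mem_inter.2 ⟨hRN hx, hRK hx⟩
  -- Both ends of the given path lie in `R`. One vertex would not suffice for the final estimate.
  have e4 : 2 ≤ #R := by
    have : ({a, c} : Finset V) ⊆ R := by
      simp only [insert_subset_iff, singleton_subset_iff, hR, mem_filter]
      exact ⟨⟨ha, c, hc, b, hb, hac.symm, hbc.symm, hab.symm⟩, hc, a, ha, b, hb, hac, hab, hbc⟩
    rw [← card_pair hac]
    exact card_le_card this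
  have e5 := card_add_card_add_one hN hW
  have e6 := sum_degree_neighbors hN hW
  have e7 := card_inter_add_card_sdiff N K
  have e8 := card_inter_add_card_sdiff W K
  have e12 := card_sdiff_add_card_eq_card hRN
  obtain ⟨s, rfl⟩ : ∃ k, s = k + 1 := ⟨s - 1, by omega⟩
  have e9 : (2 * (s + 1) - 1) / 2 = s := by omega
  have e10 : (2 * (s + 1)) / 2 = s + 1 := by omega
  rw [e9, e10] at hK
  generalize #(N ∩ K) = p₁ at *
  generalize #(N \ K) = q₁ at *
  generalize #(W ∩ K) = p₂ at *
  generalize #(W \ K) = q₂ at *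
  have e11 := Nat.mul_le_mul_left (2 * (s + 1)) e3
  -- The 2 in `q₂ + 2` counts `u` and the at most one ordered pair per vertex of `N \ R`.
  have b1 : ∑ v ∈ N, G.degree v ≤ q₁ * (q₂ + 2) + (3 * (s + 1) + 1) * (p₁ + p₂) := by
    rw [e6, ← e7]
    nlinarith
  have hp : 2 ≤ p₁ + p₂ := by omega
  have hcard : Fintype.card V = q₁ + q₂ + 1 + (p₁ + p₂) := by omega
  rw [hcard] at hn ⊢
  generalize p₁ + p₂ = p at *
  -- For the unshifted `p`, AM–GM gives `4 * q₁ * (q₂ + 2) ≤ (n - p + 1)²`; the gain `(p - 1) * (2 *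
  -- n - p + 1)` is positive only since `p ≥ 2`.
  obtain ⟨p, rfl⟩ : ∃ k, p = k + 2 := ⟨p - 2, by omega⟩
  have := Nat.mul_le_mul_left (p + 1) hn
  zify at *
  nlinarith [sq_nonneg ((q₁ : ℤ) - (q₂ + 2))]

/-- An alternating path with `r` edges from `a` ends in `W`. If its end is adjacent to `b`, the path
closes up with the triangle `a b u` to a theta graph. As `a` and `b` see almost all of `W`, the
sparse set absorbs `W` up to two vertices, and the degree sum is linear in `n` with factor `s + 4`.
-/
theorem sum_degree_lt_of_matching_edge {s : ℕ} (hs : 1 ≤ s)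
    (hn : 10 * (2 * s + 1) ≤ Fintype.card V)
    (hG : (generalizedTheta ![1, 2, 2 * s + 1 + 1]).Free G) (hN : ∀ v, v ∈ N ↔ G.Adj u v)
    (hW : ∀ v, v ∈ W ↔ v ≠ u ∧ ¬ G.Adj u v) (hmat : ∀ v ∈ N, #{w ∈ N | G.Adj v w} ≤ 1) {a b : V}
    (ha : a ∈ N) (hb : b ∈ N) (hab : G.Adj a b)
    (hpair : 2 * #W ≤ #{w ∈ W | G.Adj a w} + #{w ∈ W | G.Adj b w} + 2) :
    4 * ∑ v ∈ N, G.degree v + 1 < Fintype.card V ^ 2 := by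
  classical
  set A : Finset V := univ.erase u with hA
  have hNA : N ⊆ A := fun v hv => by simpa [A] using ((hN v).1 hv).ne'
  have hWA : W ⊆ A := fun v hv => by simpa [A] using ((hW v).1 hv).1
  have huA : u ∉ A := by simp [A]
  set Z : Finset V := {w ∈ W | ¬ G.Adj b w}
  have hadja := (hN a).1 ha
  have hadjb := (hN b).1 hb
  have haZ : a ∉ insert b Z := by
    simp only [mem_insert, not_or, Z, mem_filter, hW]
    exact ⟨hab.ne, fun h => h.1.2 hadja⟩
  have e1 : #{w ∈ W | G.Adj a w} + #{w ∈ W | ¬ G.Adj a w} = #W :=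
    card_filter_add_card_filter_not _
  have e2 : #{w ∈ W | G.Adj b w} + #Z = #W := card_filter_add_card_filter_not _
  obtain ⟨K, hKA, haK, hnK, hK⟩ := exists_sparse_of_no_path_avoiding (ℓ := 2 * s + 1)
    (crossGraph_colour_ne (G := G) (u := u)) (by omega) A (insert b Z) a (hNA ha) haZ (by
      intro l hnd hch hl hlen
      have hul := notMem_of_isChain_crossGraph hch
      have hbl : b ∉ l := fun h => (hl b h).2 (mem_insert_self _ _)
      refine hG (theta_isContained (a := a) (b := b) (c := u) (l := l) hlen ?_ ?_ hab hadja.symm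
        hadjb hul)
      · rw [← List.cons_append, ← List.concat_eq_append]
        exact hnd.concat (by rw [List.mem_cons, not_or]; exact ⟨hab.ne', hbl⟩)
      · rw [← List.cons_append, List.isChain_append]
        refine ⟨isChain_of_crossGraph hch, by simp, fun x hx y hy => ?_⟩
        simp only [List.head?_cons, Option.mem_def, Option.some.injEq] at hy
        subst hy
        have h1 := adj_iff_even_of_isChain_crossGraph hch hadja hx
        have h2 : ¬ G.Adj u x := by
          rw [h1, hlen]; simp
        have hxl : x ∈ l := by
          rcases List.mem_cons.1 (List.mem_of_getLast? (Option.mem_def.1 hx)) with rfl | h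
          · exact absurd hadja h2
          · exact h
        by_contra h3
        refine (hl x hxl).2 (mem_insert_of_mem (mem_filter.2 ⟨(hW x).2 ⟨?_, h2⟩, ?_⟩))
        · rintro rfl; exact hul hxl
        · exact fun h => h3 h.symm)
  -- `K` contains every neighbour of `a` in `W` outside `Z`.
  have e3 : #(W \ K) ≤ #{w ∈ W | ¬ G.Adj a w} + #Z := by
    refine (card_le_card fun w hw => ?_).trans (card_union_le _ _)
    rw [mem_sdiff] at hw
    rw [mem_union, mem_filter]
    by_contra hcon
    push Not at hcon
    have hwW := (hW w).1 hw.1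
    have hwb : w ≠ b := by rintro rfl; exact hwW.2 hadjb
    refine hw.2 (hnK w (mem_sdiff.2 ⟨hWA hw.1, by simp [hwb, hcon.2]⟩) ?_)
    exact ⟨hadja.ne', hwW.1, hcon.1 hw.1, fun h => hwW.2 (h.1 hadja)⟩
  have e4 : #(W \ K) ≤ 2 := by omega
  have e5 : #Z ≤ 2 := by omega
  have f1 := innerDegreeSum_crossGraph hN hW huA
  have f2 := innerDegreeSum_crossGraph_le (A := A \ K) hN hW (by simp [A])
  rw [inter_eq_left.2 hNA, inter_eq_left.2 hWA] at f1
  have f3 : N ∩ (A \ K) = N \ K := by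
    ext x; have := @hNA x; simp only [mem_inter, mem_sdiff]; tauto
  have f4 : W ∩ (A \ K) = W \ K := by
    ext x; have := @hWA x; simp only [mem_inter, mem_sdiff]; tauto
  rw [f3, f4] at f2
  -- In the avoided set, a vertex of `N` pays only for `Z`, which has at most two vertices, and a
  -- vertex of `W` only for `b`.
  have f5 : ∑ x ∈ K, ((if decide (G.Adj u x) = decide (G.Adj u a) then
        2 * ((2 * s + 1 - 1) / 2) else 2 * ((2 * s + 1) / 2)) +
      2 * #{t ∈ insert b Z | decide (G.Adj u t) ≠ decide (G.Adj u x)}) ≤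
      ∑ x ∈ K, (2 * s + if G.Adj u x then 4 else 2) := by
    refine sum_le_sum fun x _ => ?_
    have g1 : (2 * s + 1 - 1) / 2 = s := by omega
    have g2 : (2 * s + 1) / 2 = s := by omega
    rw [g1, g2, ite_self]
    refine Nat.add_le_add_left ?_ _
    split_ifs with hx
    · have : ({t ∈ insert b Z | decide (G.Adj u t) ≠ decide (G.Adj u x)} : Finset V) ⊆ Z := by
        intro t ht
        simp only [mem_filter, mem_insert, hx] at ht
        rcases ht.1 with rfl | h
        · simp [hadjb] at ht
        · exact h
      have := card_le_card this
      omega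
    · have : ({t ∈ insert b Z | decide (G.Adj u t) ≠ decide (G.Adj u x)} : Finset V) ⊆ {b} := by
        intro t ht
        simp only [mem_filter, mem_insert, hx] at ht
        rcases ht.1 with rfl | h
        · simp
        · have := ((hW t).1 (mem_filter.1 h).1).2
          simp [this] at ht
      have := card_le_card this
      rw [card_singleton] at this
      omega
  have f6 : ∑ x ∈ K, (2 * s + if G.Adj u x then 4 else 2) =
      2 * s * (#(N ∩ K) + #(W ∩ K)) + (4 * #(N ∩ K) + 2 * #(W ∩ K)) := by
    have g1 : ({x ∈ K | G.Adj u x} : Finset V) = N ∩ K := by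
      ext x; simp [hN, and_comm]
    have g2 : ({x ∈ K | ¬ G.Adj u x} : Finset V) = W ∩ K := by
      ext x
      have : x ∈ K → x ≠ u := fun h h' => huA (mem_sdiff.1 (hKA (h' ▸ h))).1
      simp only [mem_filter, mem_inter, hW]; tauto
    have g3 := card_filter_add_card_filter_not (s := K) (G.Adj u)
    rw [sum_add_distrib, sum_ite, sum_const, sum_const, sum_const]
    rw [g1, g2] at g3 ⊢
    rw [← g3]
    simp only [smul_eq_mul]
    ring
  have e6 := sum_degree_neighbors hN hW
  have e7 := card_inter_add_card_sdiff N K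
  have e8 := card_inter_add_card_sdiff W K
  have e9 := card_add_card_add_one hN hW
  have e10 : G.innerDegreeSum N ≤ #N := by
    rw [card_eq_sum_ones]; exact sum_le_sum hmat
  have e11 := Nat.mul_le_mul_left (#(N \ K)) e4
  have b1 : ∑ v ∈ N, G.degree v ≤ (s + 4) * (#N + #W) := by
    have : s * (#(N ∩ K) + #(W ∩ K)) ≤ s * (#N + #W) := Nat.mul_le_mul_left _ (by omega)
    nlinarith
  have hcard : Fintype.card V = #N + #W + 1 := e9.symm
  rw [hcard] at hn ⊢
  generalize #N + #W = k at *
  nlinarith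

theorem sum_degree_lt_of_odd {s : ℕ} (hn : 10 * (2 * s + 1) ≤ Fintype.card V)
    (hG : (generalizedTheta ![1, 2, 2 * s + 1 + 1]).Free G) (hN : ∀ v, v ∈ N ↔ G.Adj u v)
    (hW : ∀ v, v ∈ W ↔ v ≠ u ∧ ¬ G.Adj u v) {a b : V} (ha : a ∈ N) (hb : b ∈ N)
    (hab : G.Adj a b) : ∑ v ∈ N, G.degree v < Fintype.card V ^ 2 / 4 := by
  suffices h : 4 * (∑ v ∈ N, G.degree v + 1) ≤ Fintype.card V ^ 2 by
    rw [← Nat.succ_le_iff, Nat.le_div_iff_mul_le (by norm_num), mul_comm]; exact h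
  have hsq : Fintype.card V ^ 2 % 4 = 0 ∨ Fintype.card V ^ 2 % 4 = 1 := by
    rcases Nat.even_or_odd' (Fintype.card V) with ⟨k, hk | hk⟩ <;> rw [hk] <;> ring_nf <;> omega
  -- Squares are 0 or 1 modulo 4, so exceeding `4 * S + 1` means reaching `4 * S + 4`.
  have hweak : 4 * ∑ v ∈ N, G.degree v + 1 < Fintype.card V ^ 2 →
      4 * (∑ v ∈ N, G.degree v + 1) ≤ Fintype.card V ^ 2 := by omega
  have hcard := card_add_card_add_one hN hW
  have hsum := sum_degree_neighbors hN hW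
  by_cases h3 : ∃ x ∈ N, ∃ y ∈ N, ∃ z ∈ N, x ≠ z ∧ G.Adj x y ∧ G.Adj y z
  · obtain ⟨x, hx, y, hy, z, hz, hxz, hxy, hyz⟩ := h3
    rcases Nat.eq_zero_or_pos s with rfl | hs
    · exact absurd rfl (not_isChain_neighbors (u := u) hG [x, y, z] (by simp [hxz, hxy.ne, hyz.ne])
        (by simp [hxy, hyz]) (by simp [← hN, hx, hy, hz]))
    · exact hweak (sum_degree_lt_of_odd_of_three_path hs hn hG hN hW hx hy hz hxz hxy hyz)
  have hmat : ∀ v ∈ N, #{w ∈ N | G.Adj v w} ≤ 1 := by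
    intro v hv
    rw [card_le_one]
    intro x hx z hz
    rw [mem_filter] at hx hz
    by_contra hxz
    exact h3 ⟨x, hx.1, v, hv, z, hz.1, hxz, hx.2.symm, hz.2⟩
  have hle : G.innerDegreeSum N ≤ #N := by
    rw [card_eq_sum_ones]; exact sum_le_sum hmat
  have hpos : 1 ≤ G.innerDegreeSum N := by
    rw [innerDegreeSum_eq_card]
    exact card_pos.2 ⟨(a, b), by simp [ha, hb, hab]⟩
  rw [← hcard] at hn ⊢
  rcases Nat.eq_zero_or_pos s with rfl | hs
  -- For `r = 1`, adjacent vertices of `N` have no common neighbour in `W`, so `m = #W` is available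
  -- in the matching bound.
  · have hpair : ∀ a ∈ N, ∀ b ∈ N, G.Adj a b →
        #{w ∈ W | G.Adj a w} + #{w ∈ W | G.Adj b w} + #W ≤ 2 * #W := by
      intro a ha b hb hab
      have hdis : Disjoint ({w ∈ W | G.Adj a w} : Finset V) {w ∈ W | G.Adj b w} := by
        rw [Finset.disjoint_left]
        intro w hw hw'
        rw [mem_filter] at hw hw'
        have hwu := ((hW w).1 hw.1).1
        have hwa : a ≠ w := hw.2.ne
        have hwb : w ≠ b := hw'.2.ne'
        exact hG (theta_isContained (a := a) (b := b) (c := u) (l := [w]) rfl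
          (by simp [hab.ne, hwa, hwb]) (by simp [hw.2, hw'.2.symm]) hab ((hN a).1 ha).symm
          ((hN b).1 hb) (by simpa using hwu.symm))
      have := card_le_card (union_subset (filter_subset (G.Adj a) W) (filter_subset (G.Adj b) W))
      rw [card_union_of_disjoint hdis] at this
      omega
    have key := two_mul_sum_le_of_matching hmat hpair
    rw [hsum]
    generalize #N = d at *
    generalize #W = w at *
    generalize G.innerDegreeSum N = e at *
    generalize ∑ v ∈ N, #{w ∈ W | G.Adj v w} = f at *
    rcases le_or_gt 3 w with hw | hw
    · have h1 := Nat.mul_le_mul_right e hw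
      rw [mul_assoc] at key
      have h2 : e + f + 1 ≤ d * w := by omega
      zify at h2 ⊢
      nlinarith [sq_nonneg ((d : ℤ) - w - 1)]
    · obtain ⟨d, rfl⟩ : ∃ k, d = k + 7 := ⟨d - 7, by omega⟩
      interval_cases w <;> nlinarith
  -- The matching bound saves `(m - 2) / 2` per ordered pair, so `m = 3` is the least value that
  -- helps: by integrality a positive saving is at least 1, giving `S + 1 ≤ #N * (#W + 1) ≤ n² / 4`.
  · by_cases hpair : ∀ a ∈ N, ∀ b ∈ N, G.Adj a b →
        #{w ∈ W | G.Adj a w} + #{w ∈ W | G.Adj b w} + 3 ≤ 2 * #W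
    · have key := two_mul_sum_le_of_matching hmat hpair
      rw [mul_assoc] at key
      have h2 : G.innerDegreeSum N + ∑ v ∈ N, #{w ∈ W | G.Adj v w} + 1 ≤ #N * #W := by omega
      rw [hsum]
      zify at h2 ⊢
      nlinarith [sq_nonneg ((#N : ℤ) - #W - 1)]
    · push Not at hpair
      obtain ⟨x, hx, y, hy, hxy, hlt⟩ := hpair
      rw [hcard] at hn ⊢
      exact hweak (sum_degree_lt_of_matching_edge hs hn hG hN hW hmat hx hy hxy (by omega))

end SimpleGraph

/-! ### The bound on degree sums and its equality case -/

namespace SimpleGraph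

variable {V : Type*} {G : SimpleGraph V}

/-- The paths of lengths 1 and 2 form a triangle, which a bipartite graph lacks. -/
theorem theta_free_of_iso_turanGraph {r n : ℕ} (f : G ≃g turanGraph n 2) :
    (generalizedTheta ![1, 2, r + 1]).Free G := by
  intro h
  have h3 : (generalizedTheta ![1, 2, r + 1]).CliqueFree 3 :=
    (turanGraph_cliqueFree (n := n) (r := 2) (by norm_num)).comap
      (h.trans ⟨f.toCopy⟩)
  classical
  have e : ∀ (x y : ThetaVertex ![1, 2, r + 1]) (i : Fin 3) (k : ℕ), k < ![1, 2, r + 1] i →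
      x = ThetaVertex.point _ i k → y = ThetaVertex.point _ i (k + 1) → x ≠ y →
      (generalizedTheta ![1, 2, r + 1]).Adj x y := fun x y i k hk hx hy hxy => by
    rw [generalizedTheta, fromRel_adj]
    exact ⟨hxy, .inl ⟨i, k, hk, hx, hy⟩⟩
  have a1 := e .source .target 0 0 (by simp) (by simp [ThetaVertex.point])
    (by simp [ThetaVertex.point]) (by simp)
  have a2 := e .source (.inner 1 ⟨0, by simp⟩) 1 0 (by simp) (by simp [ThetaVertex.point])
    (by simp [ThetaVertex.point]) (by simp)
  have a3 := e (.inner 1 ⟨0, by simp⟩) .target 1 1 (by simp) (by simp [ThetaVertex.point])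
    (by simp [ThetaVertex.point]) (by simp)
  exact h3 _ (is3Clique_triple_iff.2 ⟨a1, a2, a3.symm⟩)

variable [Fintype V]

theorem sum_degree_lt {r : ℕ} (hr : 1 ≤ r) (hodd : Odd r → 10 * r ≤ Fintype.card V)
    (heven : Even r → 7 * r ≤ Fintype.card V) (hG : (generalizedTheta ![1, 2, r + 1]).Free G)
    [DecidableRel G.Adj] {u a b : V} (ha : G.Adj u a) (hb : G.Adj u b) (hab : G.Adj a b) :
    ∑ v ∈ G.neighborFinset u, G.degree v < Fintype.card V ^ 2 / 4 := by
  classical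
  have hN : ∀ v, v ∈ G.neighborFinset u ↔ G.Adj u v := fun v => by simp
  have hW : ∀ v, v ∈ ({v | v ≠ u ∧ ¬ G.Adj u v} : Finset V) ↔ v ≠ u ∧ ¬ G.Adj u v :=
    fun v => by simp
  rcases Nat.even_or_odd' r with ⟨s, rfl | rfl⟩
  · have := sum_degree_lt_of_even (s := s) (by omega)
      (by have := heven (even_two_mul s); omega) hG hN hW ((hN a).2 ha) ((hN b).2 hb) hab
    have hsq : Fintype.card V ^ 2 % 4 = 0 ∨ Fintype.card V ^ 2 % 4 = 1 := by
      rcases Nat.even_or_odd' (Fintype.card V) with ⟨k, hk | hk⟩ <;> rw [hk] <;> ring_nf <;> omega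
    omega
  · exact sum_degree_lt_of_odd (hodd (odd_two_mul_add_one s)) hG hN hW ((hN a).2 ha)
      ((hN b).2 hb) hab

/-- Every neighbour of `u` has all its neighbours in the complement of the neighbourhood; equality
in the sum forces equality in each term. -/
theorem sum_degree_neighborFinset_of_independent [DecidableRel G.Adj] [DecidableEq V] {u : V}
    (hu : ∀ a b, G.Adj u a → G.Adj u b → ¬ G.Adj a b) :
    ∑ v ∈ G.neighborFinset u, G.degree v ≤
      #(G.neighborFinset u) * #(G.neighborFinset u)ᶜ ∧
    (∑ v ∈ G.neighborFinset u, G.degree v =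
      #(G.neighborFinset u) * #(G.neighborFinset u)ᶜ →
        ∀ v w, G.Adj u v → ¬ G.Adj u w → G.Adj v w) := by
  have hsub : ∀ v ∈ G.neighborFinset u, G.neighborFinset v ⊆ (G.neighborFinset u)ᶜ := by
    intro v hv w hw
    simp only [mem_neighborFinset, mem_compl] at hv hw ⊢
    exact fun h => hu v w hv h hw
  have hle : ∀ v ∈ G.neighborFinset u, G.degree v ≤ #(G.neighborFinset u)ᶜ := fun v hv => by
    rw [← card_neighborFinset_eq_degree]
    exact card_le_card (hsub v hv)
  refine ⟨sum_le_card_nsmul _ _ _ hle, fun heq v w hv hw => ?_⟩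
  rw [← smul_eq_mul, ← sum_const, sum_eq_sum_iff_of_le hle] at heq
  have hv' : v ∈ G.neighborFinset u := by simpa using hv
  have h1 := eq_of_subset_of_card_le (hsub v hv')
    (by rw [card_neighborFinset_eq_degree]; exact (heq v hv').ge)
  have : w ∈ (G.neighborFinset u)ᶜ := by simpa using hw
  rw [← h1] at this
  simpa using this

theorem card_mul_card_compl_le [DecidableEq V] (s : Finset V) :
    #s * #sᶜ ≤ Fintype.card V ^ 2 / 4 := by
  rw [Nat.le_div_iff_mul_le (by norm_num), ← card_add_card_compl s]
  zify
  nlinarith [sq_nonneg ((#s : ℤ) - #sᶜ)]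

theorem sum_degree_le {r : ℕ} (hr : 1 ≤ r) (hodd : Odd r → 10 * r ≤ Fintype.card V)
    (heven : Even r → 7 * r ≤ Fintype.card V) (hG : (generalizedTheta ![1, 2, r + 1]).Free G)
    [DecidableRel G.Adj] (u : V) :
    ∑ v ∈ G.neighborFinset u, G.degree v ≤ Fintype.card V ^ 2 / 4 := by
  classical
  by_cases h : ∃ a b, G.Adj u a ∧ G.Adj u b ∧ G.Adj a b
  · obtain ⟨a, b, ha, hb, hab⟩ := h
    exact (sum_degree_lt hr hodd heven hG ha hb hab).le
  · push Not at h
    exact (sum_degree_neighborFinset_of_independent h).1.trans (card_mul_card_compl_le _)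

theorem nonempty_iso_turanGraph_two_of_sum_degree {r : ℕ} (hr : 1 ≤ r)
    (hodd : Odd r → 10 * r ≤ Fintype.card V)
    (heven : Even r → 7 * r ≤ Fintype.card V) (hG : (generalizedTheta ![1, 2, r + 1]).Free G)
    [DecidableRel G.Adj] {u : V}
    (hu : Fintype.card V ^ 2 / 4 ≤ ∑ v ∈ G.neighborFinset u, G.degree v) :
    Nonempty (G ≃g turanGraph (Fintype.card V) 2) := by
  classical
  have hind : ∀ u, Fintype.card V ^ 2 / 4 ≤ ∑ v ∈ G.neighborFinset u, G.degree v →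
      ∀ a b, G.Adj u a → G.Adj u b → ¬ G.Adj a b := fun u hu a b ha hb hab =>
    absurd (sum_degree_lt hr hodd heven hG ha hb hab) hu.not_gt
  have h1 := sum_degree_neighborFinset_of_independent (hind u hu)
  have h2 := card_mul_card_compl_le (G.neighborFinset u)
  have hcomp := h1.2 (by omega)
  set N := G.neighborFinset u with hN
  have hmem : ∀ v, v ∈ N ↔ G.Adj u v := fun v => by simp [hN]
  have hn : 7 ≤ Fintype.card V := by
    rcases Nat.even_or_odd r with h | h
    · have := heven h; omega
    · have := hodd h; omega
  have hpos : 0 < Fintype.card V ^ 2 / 4 := Nat.div_pos (by nlinarith) (by norm_num)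
  obtain ⟨v, hv⟩ : N.Nonempty := by
    rw [nonempty_iff_ne_empty]
    intro h0
    rw [h0, sum_empty] at hu
    omega
  rw [hmem] at hv
  have hNv : G.neighborFinset v = Nᶜ := by
    ext w
    rw [mem_neighborFinset, mem_compl, hmem]
    exact ⟨fun hvw huw => hind u hu v w hv huw hvw, hcomp v w hv⟩
  -- The complement of `N` is the neighbourhood of `v`, and its vertices have degree at least `#N`.
  -- So the degree sum at `v` is also extremal, and `hind` applies to `v`.
  have hNc : ∀ a b, a ∉ N → b ∉ N → ¬ G.Adj a b := by
    intro a b ha hb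
    refine hind v ?_ a b ?_ ?_
    · rw [hNv]
      refine le_trans (by rw [mul_comm]; omega : _ ≤ #Nᶜ * #N) ?_
      refine card_nsmul_le_sum _ _ _ fun w hw => ?_
      rw [← card_neighborFinset_eq_degree]
      refine card_le_card fun x hx => ?_
      rw [mem_compl, hmem] at hw
      rw [hmem] at hx
      rw [mem_neighborFinset]
      exact (hcomp x w hx hw).symm
    · rw [← mem_neighborFinset, hNv, mem_compl]; exact ha
    · rw [← mem_neighborFinset, hNv, mem_compl]; exact hb
  have hbip : G.IsBipartiteWith (N : Set V) (Nᶜ : Finset V) := by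
    refine ⟨by rw [disjoint_coe]; exact disjoint_compl_right, fun x y hxy => ?_⟩
    simp only [mem_coe, mem_compl]
    by_cases hx : x ∈ N
    · exact .inl ⟨hx, fun hy => hind u hu x y ((hmem x).1 hx) ((hmem y).1 hy) hxy⟩
    · by_cases hy : y ∈ N
      · exact .inr ⟨hx, hy⟩
      · exact absurd hxy (hNc x y hx hy)
  have hE := isBipartiteWith_sum_degrees_eq_card_edges hbip
  -- In a bipartite graph the degree sum over one side counts the edges, so `hu` says that their
  -- number reaches Turán's bound.
  refine IsTuranMaximal.nonempty_iso_turanGraph ⟨?_, ?_⟩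
  · intro t ht
    obtain ⟨x, y, z, hxy, hxz, hyz, -⟩ := is3Clique_iff.1 ht
    have e1 := hbip.mem_of_adj hxy
    have e2 := hbip.mem_of_adj hxz
    have e3 := hbip.mem_of_adj hyz
    simp only [mem_coe, mem_compl] at e1 e2 e3
    tauto
  · intro G' _ hG'
    have := hG'.card_edgeFinset_le
    rw [← hE]
    refine le_trans ?_ hu
    refine this.trans ?_
    have hm := Nat.mod_two_eq_zero_or_one (Fintype.card V)
    rcases hm with hm | hm <;> rw [hm] <;> simp
    omega

/-! ### Spectral radius and degree sums -/

section Spectral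

theorem exists_mulVec_eq_of_mem_spectrum [DecidableEq V] {A : Matrix V V ℝ} {k : ℝ}
    (hk : k ∈ spectrum ℝ A) : ∃ x : V → ℝ, x ≠ 0 ∧ A.mulVec x = k • x := by
  rw [← Matrix.spectrum_toLin', ← Module.End.hasEigenvalue_iff_mem_spectrum] at hk
  obtain ⟨x, hx⟩ := hk.exists_hasEigenvector
  exact ⟨x, hx.2, by simpa using hx.apply_eq_smul⟩

theorem mem_spectrum_of_mulVec_eq [DecidableEq V] {A : Matrix V V ℝ} {k : ℝ} {x : V → ℝ}
    (hx : x ≠ 0) (h : A.mulVec x = k • x) : k ∈ spectrum ℝ A := by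
  rw [← Matrix.spectrum_toLin', ← Module.End.hasEigenvalue_iff_mem_spectrum]
  exact Module.End.hasEigenvalue_of_hasEigenvector (x := x)
    ⟨Module.End.mem_eigenspace_iff.2 (by simpa using h), hx⟩

theorem spectralRadius_eq_of_nonempty [DecidableEq V] {A : Matrix V V ℝ}
    (hA : (spectrum ℝ A).Nonempty) :
    ∃ k ∈ spectrum ℝ A, (spectralRadius ℝ A).toReal = |k| ∧ ∀ k' ∈ spectrum ℝ A, |k'| ≤ |k| := by
  obtain ⟨k, hk, hmax⟩ := Set.exists_max_image _ (fun k : ℝ => ‖k‖₊) (Matrix.finite_spectrum A) hA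
  refine ⟨k, hk, ?_, fun k' hk' => by
    have := hmax k' hk'
    simpa [← NNReal.coe_le_coe] using this⟩
  have : spectralRadius ℝ A = ‖k‖₊ := by
    refine le_antisymm (iSup₂_le fun k' hk' => ?_) (le_iSup₂ (f := fun k _ => (‖k‖₊ : ENNReal)) k hk)
    exact_mod_cast hmax k' hk'
  rw [this]
  simp

/-- Apply the eigenvalue equation twice at a vertex where the eigenvector has largest modulus: the
resulting double sum has as many terms as the degree sum counts. -/
theorem sq_le_sum_degree_of_mem_spectrum [DecidableEq V] [DecidableRel G.Adj] {k : ℝ}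
    (hk : k ∈ spectrum ℝ (G.adjMatrix ℝ)) :
    ∃ u, k ^ 2 ≤ ((∑ v ∈ G.neighborFinset u, G.degree v : ℕ) : ℝ) := by
  obtain ⟨x, hx0, hx⟩ := exists_mulVec_eq_of_mem_spectrum hk
  obtain ⟨v₀, hv₀⟩ := Function.ne_iff.1 hx0
  obtain ⟨u, -, hu⟩ := exists_max_image univ (fun v => |x v|) ⟨v₀, mem_univ _⟩
  have hpos : 0 < |x u| := (abs_pos.2 hv₀).trans_le (hu v₀ (mem_univ _))
  have hv : ∀ v, k * x v = ∑ w ∈ G.neighborFinset v, x w := fun v => by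
    rw [← adjMatrix_mulVec_apply, hx]; rfl
  have h2 : k ^ 2 * x u = ∑ v ∈ G.neighborFinset u, ∑ w ∈ G.neighborFinset v, x w := by
    rw [pow_two, mul_assoc, hv, mul_sum]
    exact sum_congr rfl fun v _ => hv v
  refine ⟨u, le_of_mul_le_mul_right ?_ hpos⟩
  calc k ^ 2 * |x u| = |k ^ 2 * x u| := by rw [abs_mul, abs_of_nonneg (sq_nonneg k)]
    _ ≤ ∑ v ∈ G.neighborFinset u, ∑ w ∈ G.neighborFinset v, |x u| := by
      rw [h2]
      refine (abs_sum_le_sum_abs _ _).trans (sum_le_sum fun v _ => ?_)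
      exact (abs_sum_le_sum_abs _ _).trans (sum_le_sum fun w _ => hu w (mem_univ _))
    _ = _ := by
      simp only [sum_const, card_neighborFinset_eq_degree, nsmul_eq_mul]
      rw [← sum_mul, Nat.cast_sum]

theorem exists_graphSpectralRadius_sq_le [Nonempty V] [DecidableRel G.Adj] :
    ∃ u, graphSpectralRadius G ^ 2 ≤ ((∑ v ∈ G.neighborFinset u, G.degree v : ℕ) : ℝ) := by
  classical
  have key : ∀ A : Matrix V V ℝ, A = G.adjMatrix ℝ →
      ∃ u, (spectralRadius ℝ A).toReal ^ 2 ≤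
        ((∑ v ∈ G.neighborFinset u, G.degree v : ℕ) : ℝ) := by
    rintro A rfl
    -- An empty real spectrum is not excluded by symmetry here; it would give spectral radius 0, for
    -- which the bound is trivial.
    rcases (spectrum ℝ (G.adjMatrix ℝ)).eq_empty_or_nonempty with h | h
    · refine ⟨Classical.arbitrary V, ?_⟩
      have h0 : spectralRadius ℝ (G.adjMatrix ℝ) = 0 := by simp [spectralRadius, h]
      rw [h0, ENNReal.toReal_zero, zero_pow two_ne_zero]
      exact Nat.cast_nonneg _
    · obtain ⟨k, hk, hk', -⟩ := spectralRadius_eq_of_nonempty h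
      rw [hk', sq_abs]
      exact sq_le_sum_degree_of_mem_spectrum hk
  unfold graphSpectralRadius
  convert! key _ ?_ using 8
  congr!

theorem le_graphSpectralRadius [DecidableRel G.Adj] {k : ℝ} {x : V → ℝ} (hx : x ≠ 0)
    (h : (G.adjMatrix ℝ).mulVec x = k • x) : k ≤ graphSpectralRadius G := by
  classical
  have hk := mem_spectrum_of_mulVec_eq hx h
  obtain ⟨k', -, hk1, hk2⟩ := spectralRadius_eq_of_nonempty ⟨k, hk⟩
  have : k ≤ (spectralRadius ℝ (G.adjMatrix ℝ)).toReal := by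
    rw [hk1]
    exact (le_abs_self k).trans (hk2 k hk)
  refine this.trans_eq ?_
  unfold graphSpectralRadius
  congr!

theorem card_filter_mod_two (n : ℕ) :
    #{j : Fin n | (j : ℕ) % 2 = 0} = (n + 1) / 2 ∧ #{j : Fin n | ¬ (j : ℕ) % 2 = 0} = n / 2 := by
  have h1 : #{j : Fin n | (j : ℕ) % 2 = 0} = (n + 1) / 2 := by
    rw [card_filter, Fin.sum_univ_eq_sum_range (fun j => if j % 2 = 0 then 1 else 0) n]
    induction n with
    | zero => rfl
    | succ n ih =>
      rw [sum_range_succ, ih]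
      split_ifs <;> omega
  have h2 := card_filter_add_card_filter_not (s := (univ : Finset (Fin n))) fun j => (j : ℕ) % 2 = 0
  rw [card_univ, Fintype.card_fin] at h2
  exact ⟨h1, by omega⟩

theorem sqrt_le_graphSpectralRadius_of_iso {n : ℕ} (hn : 2 ≤ n) (f : G ≃g turanGraph n 2) :
    √((n ^ 2 / 4 : ℕ) : ℝ) ≤ graphSpectralRadius G := by
  classical
  obtain ⟨hp, hq⟩ := card_filter_mod_two n
  set p := (n + 1) / 2 with hp'
  set q := n / 2 with hq'
  have hpq : n ^ 2 / 4 = p * q := by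
    rcases Nat.even_or_odd' n with ⟨k, hk | hk⟩
    · have e1 : p = k := by omega
      have e2 : q = k := by omega
      rw [e1, e2, hk]
      exact Nat.div_eq_of_eq_mul_left (by norm_num) (by ring)
    · have e1 : p = k + 1 := by omega
      have e2 : q = k := by omega
      rw [e1, e2, hk]
      refine Nat.div_eq_of_lt_le ?_ ?_ <;> nlinarith
  have hsq : √((p : ℝ) * q) = √p * √q := Real.sqrt_mul (by positivity) _
  rw [hpq, Nat.cast_mul]
  have hadj : ∀ v w, G.Adj v w ↔ ((f v : Fin n) : ℕ) % 2 ≠ ((f w : Fin n) : ℕ) % 2 := fun v w => by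
    rw [← f.map_adj_iff]; rfl
  have hcount : ∀ (P : ℕ → Prop) [DecidablePred P],
      #{w : V | P ((f w : Fin n) : ℕ)} = #{j : Fin n | P (j : ℕ)} := by
    intro P _
    refine card_bij (fun w _ => f w) (by simp) (fun _ _ _ _ h => f.injective h) fun j hj => ?_
    exact ⟨f.symm j, by simpa using hj, by simp⟩
  -- On parts of sizes `p` and `q` the weights `√q` and `√p` are balanced: `q * √p = √(p * q) * √q`,
  -- and symmetrically.
  refine le_graphSpectralRadius (x := fun v => if ((f v : Fin n) : ℕ) % 2 = 0 then √q else √p) ?_ ?_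
  · intro h0
    have := congrFun h0 (f.symm ⟨0, by omega⟩)
    simp at this
    omega
  · ext v
    rw [adjMatrix_mulVec_apply, Pi.smul_apply, smul_eq_mul, hsq]
    by_cases hv : ((f v : Fin n) : ℕ) % 2 = 0
    · have hnb : G.neighborFinset v = ({w | ¬ ((f w : Fin n) : ℕ) % 2 = 0} : Finset V) := by
        ext w
        simp only [mem_neighborFinset, hadj, mem_filter, mem_univ, true_and]
        omega
      rw [hnb, sum_congr rfl (fun w hw => if_neg (mem_filter.1 hw).2), sum_const,
        hcount (fun j => ¬ j % 2 = 0), hq, if_pos hv, nsmul_eq_mul, mul_assoc,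
        Real.mul_self_sqrt (by positivity), mul_comm]
    · have hnb : G.neighborFinset v = ({w | ((f w : Fin n) : ℕ) % 2 = 0} : Finset V) := by
        ext w
        simp only [mem_neighborFinset, hadj, mem_filter, mem_univ, true_and]
        omega
      rw [hnb, sum_congr rfl (fun w hw => if_pos (mem_filter.1 hw).2), sum_const,
        hcount (fun j => j % 2 = 0), hp, if_neg hv, nsmul_eq_mul, mul_right_comm,
        Real.mul_self_sqrt (by positivity)]

end Spectral

/-! ### The extremal value and the extremal graph -/

theorem graphSpectralRadius_sq_le {r : ℕ} (hr : 1 ≤ r) (hodd : Odd r → 10 * r ≤ Fintype.card V)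
    (heven : Even r → 7 * r ≤ Fintype.card V) (hG : (generalizedTheta ![1, 2, r + 1]).Free G) :
    graphSpectralRadius G ^ 2 ≤ ((Fintype.card V ^ 2 / 4 : ℕ) : ℝ) ∧
      (graphSpectralRadius G ^ 2 = ((Fintype.card V ^ 2 / 4 : ℕ) : ℝ) →
        Nonempty (G ≃g turanGraph (Fintype.card V) 2)) := by
  classical
  have hn : 0 < Fintype.card V := by
    rcases Nat.even_or_odd r with h | h
    · have := heven h; omega
    · have := hodd h; omega
  have : Nonempty V := Fintype.card_pos_iff.1 hn
  obtain ⟨u, hu⟩ := exists_graphSpectralRadius_sq_le (G := G)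
  refine ⟨hu.trans (Nat.cast_le.2 (sum_degree_le hr hodd heven hG u)), fun heq => ?_⟩
  rw [heq, Nat.cast_le] at hu
  exact nonempty_iso_turanGraph_two_of_sum_degree hr hodd heven hG hu

theorem exSp_theta {r n : ℕ} (hr : 1 ≤ r) (hodd : Odd r → 10 * r ≤ n)
    (heven : Even r → 7 * r ≤ n) :
    exSp n (generalizedTheta ![1, 2, r + 1]) = √((n ^ 2 / 4 : ℕ) : ℝ) := by
  have hn : 2 ≤ n := by
    rcases Nat.even_or_odd r with h | h
    · have := heven h; omega
    · have := hodd h; omega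
  have hfree : (generalizedTheta ![1, 2, r + 1]).Free (turanGraph n 2) :=
    theta_free_of_iso_turanGraph (r := r) Iso.refl
  obtain ⟨⟨G, hG, hGe⟩, hub⟩ := exSp_isGreatest n _ ⟨_, hfree⟩
  refine le_antisymm ?_ ((sqrt_le_graphSpectralRadius_of_iso hn Iso.refl).trans
    (hub ⟨_, hfree, rfl⟩))
  rw [← hGe]
  refine Real.le_sqrt_of_sq_le ?_
  have := (graphSpectralRadius_sq_le (G := G) hr (by simpa using hodd) (by simpa using heven) hG).1
  simpa only [Fintype.card_fin] using this

end SimpleGraph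

theorem theorem1p4 (r n : ℕ) (hr : 1 ≤ r)
    (hodd : Odd r → 10 * r ≤ n) (heven : Even r → 7 * r ≤ n)
    {V : Type*} [Fintype V] (hV : Fintype.card V = n) (G : SimpleGraph V) :
    IsSpectralExtremal (generalizedTheta ![1, 2, r + 1]) G ↔
      Nonempty (G ≃g SimpleGraph.turanGraph n 2) := by
  subst hV
  have hn : 2 ≤ Fintype.card V := by
    rcases Nat.even_or_odd r with h | h
    · have := heven h; omega
    · have := hodd h; omega
  rw [IsSpectralExtremal, SimpleGraph.exSp_theta hr hodd heven]
  constructor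
  · rintro ⟨hfree, hG⟩
    refine (SimpleGraph.graphSpectralRadius_sq_le hr hodd heven hfree).2 ?_
    rw [hG, Real.sq_sqrt (Nat.cast_nonneg _)]
  · rintro ⟨f⟩
    have hfree := SimpleGraph.theta_free_of_iso_turanGraph (r := r) f
    refine ⟨hfree, le_antisymm ?_ (SimpleGraph.sqrt_le_graphSpectralRadius_of_iso hn f)⟩
    exact Real.le_sqrt_of_sq_le (SimpleGraph.graphSpectralRadius_sq_le hr hodd heven hfree).1
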